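/- Let $\Gamma$ be a finite simple graph with vertex set $V$ whose edges $e$ are labelled by integers $\mu(e)\ge 2$. Let $A_\Gamma$ be the associated Artin group, generated by $V$ with, for every edge $e=\{s,t\}$, the relation $sts\cdots = tst\cdots$ (both sides of length $\mu(e)$). For a subset $U\subset V$ let $A_U$ be the subgroup of $A_\Gamma$ generated by $U$. The clique-cube complex $C_\Gamma$ is the cube complex whose vertices are the cosets $gA_U$, where $g\in A_\Gamma$ and $U\subset V$ is empty or spans a clique of $\Gamma$, and whose cubes are the cubes $[gA_U,gA_{U'}]$ of dimension $\#(U'\setminus U)$ with vertices $gA_T$, $U\subset T\subset U'$, for $g\in A_\Gamma$ and $U\subset U'$ with $U'$ empty or spanning a clique. A cube complex is called reducible if it is the product of two subcomplexes, neither of which is a single point. Let $\Gamma^t$ be the graph with vertex set $V$ in which two distinct vertices are joined by an edge unless they are joined by an edge of $\Gamma$ with label $2$. The following are equivalent: 1. $C_\Gamma$ is reducible. 2. $A_\Gamma$ is reducible, that is, $\Gamma$ is the join of two nonempty subgraphs such that all edges between them are labelled by $2$. Equivalently, $\Gamma^t$ is disconnected (some two vertices are not joined by a path in $\Gamma^t$).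 3. Statement 2 holds and, moreover, whenever $\Gamma$ is the join of two nonempty subgraphs $\Gamma'$ and $\Gamma''$ such that all edges between them are labelled by $2$, the cube complex $C_\Gamma$ is isomorphic to the product $C_{\Gamma'}\times C_{\Gamma''}$. -/

import Mathlib

open scoped Pointwise

universe u v

/-! ### Combinatorial cube complexes -/

/-- The vertex sets of the (nonempty) faces of the standard cube `[0,1]^ι`, whose vertex set is
`ι → Bool`: a face is obtained by prescribing the coordinates in a set `s`. -/
def IsFaceOfStandardCube {ι : Type u} (F : Set (ι → Bool)) : Prop :=
  ∃ (s : Set ι) (a : ι → Bool), F = {x | ∀ i ∈ s, x i = a i}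

/-- `Q` is the vertex set of an embedded cube with coordinates indexed by `ι`, and the members of
the family `cubes` which are contained in `Q` are exactly the faces of that cube. -/
def IsCubeWithCoordinates {α : Type u} (cubes : Set α → Prop) (ι : Type v) (Q : Set α) : Prop :=
  ∃ f : (ι → Bool) → α, Function.Injective f ∧ Set.range f = Q ∧
    ∀ R : Set α, R ⊆ Q → (cubes R ↔ ∃ F : Set (ι → Bool), IsFaceOfStandardCube F ∧ f '' F = R)

/-- A cube complex with vertex set `α`, in combinatorial form.  It is given by its cubes; a cube is
recorded by the set of its vertices.  Every vertex is a (`0`-dimensional) cube, and every cube is,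
together with the cubes contained in it, a standard cube `[0,1]^n` together with its faces.
So the complex is obtained by gluing cubes of finite dimension along faces, and it is the type of
cube complex in which every cube is embedded and determined by its vertices. -/
structure CubeComplex (α : Type u) where
  IsCube : Set α → Prop
  isCube_singleton : ∀ x : α, IsCube {x}
  exists_coordinates : ∀ Q : Set α, IsCube Q → ∃ n : ℕ, IsCubeWithCoordinates IsCube (Fin n) Q

theorem IsCubeWithCoordinates.exists_fin {α : Type u} {cubes : Set α → Prop} {ι : Type v}
    [Finite ι] {Q : Set α} (h : IsCubeWithCoordinates cubes ι Q) :
    ∃ n : ℕ, IsCubeWithCoordinates cubes (Fin n) Q := by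
  obtain ⟨n, ⟨e⟩⟩ := Finite.exists_equiv_fin ι
  obtain ⟨f, hf, hr, hc⟩ := h
  let E : (Fin n → Bool) ≃ (ι → Bool) := Equiv.arrowCongr e.symm (Equiv.refl Bool)
  have hE : ∀ x i, E x i = x (e i) := fun x i => rfl
  refine ⟨n, fun x => f (E x), hf.comp E.injective, ?_, fun R hR => ?_⟩
  · rw [← hr]; exact E.surjective.range_comp f
  · rw [hc R hR]
    constructor
    · rintro ⟨F, ⟨s, a, rfl⟩, rfl⟩
      refine ⟨E ⁻¹' {x | ∀ i ∈ s, x i = a i}, ⟨e '' s, E.symm a, ?_⟩, ?_⟩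
      · ext x
        have ha : ∀ i, E.symm a (e i) = a i := fun i => by
          rw [← hE (E.symm a), E.apply_symm_apply]
        constructor
        · rintro hx _ ⟨i, hi, rfl⟩
          rw [ha, ← hx i hi, hE]
        · intro hx i hi
          rw [hE, hx _ ⟨i, hi, rfl⟩, ha]
      · rw [show (fun x => f (E x)) = f ∘ E from rfl, Set.image_comp,
          Set.image_preimage_eq _ E.surjective]
    · rintro ⟨F, ⟨s, a, rfl⟩, rfl⟩
      refine ⟨E '' {x | ∀ i ∈ s, x i = a i}, ⟨e ⁻¹' s, E a, ?_⟩, ?_⟩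
      · ext y
        constructor
        · rintro ⟨x, hx, rfl⟩ i hi
          exact hx _ hi
        · intro hy
          refine ⟨E.symm y, fun j hj => ?_, E.apply_symm_apply y⟩
          have := hy (e.symm j) (by simpa using hj)
          rw [hE, e.apply_symm_apply] at this
          rw [← this, ← E.apply_symm_apply y, hE, e.apply_symm_apply, E.apply_symm_apply]
      · rw [show (fun x => f (E x)) = f ∘ E from rfl, Set.image_comp]

namespace CubeComplex

/-- The product of two cube complexes: its cubes are the products of a cube of the first factor
and a cube of the second factor. -/
def prod {α : Type u} {β : Type v} (X : CubeComplex α) (Y : CubeComplex β) :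
    CubeComplex (α × β) where
  IsCube Q := ∃ (A : Set α) (B : Set β), X.IsCube A ∧ Y.IsCube B ∧ Q = A ×ˢ B
  isCube_singleton x :=
    ⟨{x.1}, {x.2}, X.isCube_singleton _, Y.isCube_singleton _, by ext; simp [Prod.ext_iff]⟩
  exists_coordinates := by
    rintro Q ⟨A, B, hA, hB, rfl⟩
    obtain ⟨n, f, hf, rfl, hfc⟩ := X.exists_coordinates A hA
    obtain ⟨m, g, hg, rfl, hgc⟩ := Y.exists_coordinates B hB
    have key : IsCubeWithCoordinates
        (fun Q => ∃ (A : Set α) (B : Set β), X.IsCube A ∧ Y.IsCube B ∧ Q = A ×ˢ B)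
        (Fin n ⊕ Fin m) (Set.range f ×ˢ Set.range g) := by
      refine ⟨fun x => (f (x ∘ Sum.inl), g (x ∘ Sum.inr)), ?_, ?_, fun R hR => ⟨?_, ?_⟩⟩
      · intro x y hxy
        have h1 := hf (congrArg Prod.fst hxy)
        have h2 := hg (congrArg Prod.snd hxy)
        ext (i | i)
        · exact congrFun h1 i
        · exact congrFun h2 i
      · ext ⟨p, q⟩
        constructor
        · rintro ⟨x, hx⟩
          rw [← hx]
          exact ⟨⟨_, rfl⟩, ⟨_, rfl⟩⟩
        · rintro ⟨⟨a, ha⟩, ⟨b, hb⟩⟩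
          exact ⟨Sum.elim a b, Prod.ext ha hb⟩
      · rintro ⟨C, D, hC, hD, rfl⟩
        have hCne : C.Nonempty := by
          obtain ⟨k, h, -, rfl, -⟩ := X.exists_coordinates C hC
          exact Set.range_nonempty h
        have hDne : D.Nonempty := by
          obtain ⟨k, h, -, rfl, -⟩ := Y.exists_coordinates D hD
          exact Set.range_nonempty h
        have hsub := (Set.prod_subset_prod_iff.1 hR).resolve_right (by
          rintro (h | h)
          · exact hCne.ne_empty h
          · exact hDne.ne_empty h)
        obtain ⟨F, ⟨s, a, rfl⟩, rfl⟩ := (hfc C hsub.1).1 hC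
        obtain ⟨G, ⟨t, b, rfl⟩, rfl⟩ := (hgc D hsub.2).1 hD
        refine ⟨{x | ∀ i ∈ (Sum.inl '' s ∪ Sum.inr '' t : Set (Fin n ⊕ Fin m)),
          x i = Sum.elim a b i}, ⟨_, _, rfl⟩, ?_⟩
        ext ⟨p, q⟩
        constructor
        · rintro ⟨x, hx, hpq⟩
          rw [← hpq]
          exact ⟨⟨_, fun i hi => hx (Sum.inl i) (Or.inl ⟨i, hi, rfl⟩), rfl⟩,
            ⟨_, fun i hi => hx (Sum.inr i) (Or.inr ⟨i, hi, rfl⟩), rfl⟩⟩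
        · rintro ⟨⟨x, hx, hp⟩, ⟨y, hy, hq⟩⟩
          refine ⟨Sum.elim x y, ?_, by simp_all⟩
          rintro _ (⟨i, hi, rfl⟩ | ⟨i, hi, rfl⟩)
          · exact hx i hi
          · exact hy i hi
      · rintro ⟨F, ⟨s, a, rfl⟩, rfl⟩
        refine ⟨f '' {x | ∀ i ∈ Sum.inl ⁻¹' s, x i = (a ∘ Sum.inl) i},
          g '' {x | ∀ i ∈ Sum.inr ⁻¹' s, x i = (a ∘ Sum.inr) i},
          (hfc _ (Set.image_subset_range _ _)).2 ⟨_, ⟨_, _, rfl⟩, rfl⟩,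
          (hgc _ (Set.image_subset_range _ _)).2 ⟨_, ⟨_, _, rfl⟩, rfl⟩, ?_⟩
        ext ⟨p, q⟩
        constructor
        · rintro ⟨x, hx, hpq⟩
          rw [← hpq]
          exact ⟨⟨_, fun i hi => hx (Sum.inl i) hi, rfl⟩, ⟨_, fun i hi => hx (Sum.inr i) hi, rfl⟩⟩
        · rintro ⟨⟨x, hx, hp⟩, ⟨y, hy, hq⟩⟩
          refine ⟨Sum.elim x y, ?_, by simp_all⟩
          rintro (i | i) hi
          · exact hx i hi
          · exact hy i hi
    exact key.exists_fin

/-- A subcomplex of a cube complex: a set of cubes which contains every face of each of its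
members. -/
structure Subcomplex {α : Type u} (X : CubeComplex α) where
  cubes : Set (Set α)
  isCube_of_mem : ∀ Q ∈ cubes, X.IsCube Q
  mem_of_subset : ∀ Q ∈ cubes, ∀ R : Set α, X.IsCube R → R ⊆ Q → R ∈ cubes

/-- The vertices of a subcomplex. -/
def Subcomplex.verts {α : Type u} {X : CubeComplex α} (C : X.Subcomplex) : Set α :=
  {x | {x} ∈ C.cubes}

/-- A subcomplex, considered as a cube complex in its own right. -/
def Subcomplex.toCubeComplex {α : Type u} {X : CubeComplex α} (C : X.Subcomplex) :
    CubeComplex C.verts where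
  IsCube Q := Subtype.val '' Q ∈ C.cubes
  isCube_singleton x := by
    have h : {x.1} ∈ C.cubes := x.2
    simpa using h
  exists_coordinates Q hQ := by
    obtain ⟨n, f, hf, hr, hc⟩ := X.exists_coordinates _ (C.isCube_of_mem _ hQ)
    have hmem : ∀ x, f x ∈ C.verts := fun x => by
      have : f x ∈ Subtype.val '' Q := hr ▸ Set.mem_range_self x
      obtain ⟨y, -, hy⟩ := this
      exact hy ▸ y.2
    have hval : ∀ F : Set (Fin n → Bool),
        Subtype.val '' ((fun x => (⟨f x, hmem x⟩ : C.verts)) '' F) = f '' F := fun F => by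
      rw [Set.image_image]
    refine ⟨n, fun x => ⟨f x, hmem x⟩, fun x y h => hf (congrArg Subtype.val h), ?_,
      fun R hR => ?_⟩
    · apply Subtype.val_injective.image_injective
      rw [← Set.image_univ, hval, Set.image_univ, hr]
    · have hR' : Subtype.val '' R ⊆ Subtype.val '' Q := Set.image_mono hR
      have h1 : Subtype.val '' R ∈ C.cubes ↔ X.IsCube (Subtype.val '' R) :=
        ⟨C.isCube_of_mem _, fun h => C.mem_of_subset _ hQ _ h hR'⟩
      refine (h1.trans (hc _ hR')).trans ?_
      refine exists_congr fun F => and_congr_right fun _ => ?_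
      rw [← hval]
      exact Subtype.val_injective.image_injective.eq_iff

/-- An isomorphism of cube complexes: a bijection of the vertices which maps cubes to cubes, in
both directions. -/
structure Iso {α : Type u} {β : Type v} (X : CubeComplex α) (Y : CubeComplex β) where
  toEquiv : α ≃ β
  isCube_iff : ∀ Q : Set α, X.IsCube Q ↔ Y.IsCube (toEquiv '' Q)

/-- A cube complex is reducible if it is (isomorphic to) the product of two subcomplexes, neither
of which is a single point. -/
def IsReducible {α : Type u} (X : CubeComplex α) : Prop :=
  ∃ C' C'' : X.Subcomplex, C'.verts.Nontrivial ∧ C''.verts.Nontrivial ∧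
    Nonempty (Iso (C'.toCubeComplex.prod C''.toCubeComplex) X)

end CubeComplex

/-! ### Defining graphs and Artin groups -/

/-- A simple graph with vertex set `V` whose edges are labelled by integers `≥ 2`.  The value of
`label` at a pair which is not an edge is irrelevant. -/
structure DefiningGraph (V : Type u) where
  graph : SimpleGraph V
  label : Sym2 V → ℕ
  two_le_label : ∀ e ∈ graph.edgeSet, 2 ≤ label e

/-- The alternating product `a * b * a * ⋯` with `n` factors. -/
def alternatingProduct {G : Type u} [Group G] (a b : G) : ℕ → G
  | 0 => 1
  | n + 1 => a * alternatingProduct b a n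

namespace DefiningGraph

variable {V : Type u}

/-- The relators `(s t s ⋯) (t s t ⋯)⁻¹`, with `μ(e)` factors each, for all edges `e = {s, t}`. -/
def artinRelators (Γ : DefiningGraph V) : Set (FreeGroup V) :=
  {r | ∃ s t : V, Γ.graph.Adj s t ∧
    r = alternatingProduct (FreeGroup.of s) (FreeGroup.of t) (Γ.label s(s, t)) *
      (alternatingProduct (FreeGroup.of t) (FreeGroup.of s) (Γ.label s(s, t)))⁻¹}

/-- The Artin group `A_Γ`. -/
abbrev ArtinGroup (Γ : DefiningGraph V) : Type u :=
  PresentedGroup Γ.artinRelators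

/-- The subgroup `A_U` of `A_Γ` generated by `U`. -/
def standardSubgroup (Γ : DefiningGraph V) (U : Finset V) : Subgroup Γ.ArtinGroup :=
  Subgroup.closure (PresentedGroup.of '' (U : Set V))

theorem standardSubgroup_mono (Γ : DefiningGraph V) {U T : Finset V} (h : U ⊆ T) :
    Γ.standardSubgroup U ≤ Γ.standardSubgroup T :=
  Subgroup.closure_mono (Set.image_mono (Finset.coe_subset.2 h))

/-- A subgraph of `Γ`, with the labels of `Γ`. -/
def restrict (Γ : DefiningGraph V) (H : Γ.graph.Subgraph) : DefiningGraph H.verts where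
  graph := H.coe
  label e := Γ.label (e.map Subtype.val)
  two_le_label e he := by
    refine Γ.two_le_label _ ?_
    induction e using Sym2.ind with
    | _ x y => exact H.adj_sub he

/-- `Γ` is the join of the two (nonempty) subgraphs `Γ'` and `Γ''`, and all edges of `Γ` between
`Γ'` and `Γ''` are labelled by `2`. -/
structure IsTwoLabelledJoin (Γ : DefiningGraph V) (Γ' Γ'' : Γ.graph.Subgraph) : Prop where
  nonempty_left : Γ'.verts.Nonempty
  nonempty_right : Γ''.verts.Nonempty
  disjoint : Disjoint Γ'.verts Γ''.verts
  union_eq : Γ'.verts ∪ Γ''.verts = Set.univ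
  adj_iff : ∀ s t : V, Γ.graph.Adj s t ↔ Γ'.Adj s t ∨ Γ''.Adj s t ∨
    (s ∈ Γ'.verts ∧ t ∈ Γ''.verts) ∨ (s ∈ Γ''.verts ∧ t ∈ Γ'.verts)
  label_eq_two : ∀ s ∈ Γ'.verts, ∀ t ∈ Γ''.verts, Γ.label s(s, t) = 2

/-- The Artin group `A_Γ` is reducible: its defining graph is a join of two subgraphs such that all
edges between them are labelled by `2`. -/
def IsReducible (Γ : DefiningGraph V) : Prop :=
  ∃ Γ' Γ'' : Γ.graph.Subgraph, Γ.IsTwoLabelledJoin Γ' Γ''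

/-- The graph `Γ^t`: two distinct vertices are joined by an edge unless they are joined in `Γ` by an
edge with label `2`. -/
def tGraph (Γ : DefiningGraph V) : SimpleGraph V where
  Adj s t := s ≠ t ∧ (Γ.graph.Adj s t → 3 ≤ Γ.label s(s, t))
  symm := ⟨fun s t h => ⟨h.1.symm, fun h' => Sym2.eq_swap (a := s) (b := t) ▸ h.2 h'.symm⟩⟩
  loopless := ⟨fun _ h => h.1 rfl⟩

/-! ### The clique-cube complex -/

/-- A vertex of the clique-cube complex: a coset `g A_U`, where `U` is empty or spans a clique.
The set `U` is recorded along with the coset `g A_U ⊆ A_Γ` (it is determined by the coset). -/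
@[ext]
structure CliqueVertex (Γ : DefiningGraph V) where
  type : Finset V
  coset : Set Γ.ArtinGroup
  isClique : Γ.graph.IsClique (type : Set V)
  exists_rep : ∃ g : Γ.ArtinGroup, coset = g • (Γ.standardSubgroup type : Set Γ.ArtinGroup)

/-- The (vertex set of the) cube `[g A_U, g A_U']`; its vertices are the cosets `g A_T` with
`U ⊆ T ⊆ U'`. -/
def cliqueCube (Γ : DefiningGraph V) (g : Γ.ArtinGroup) (U U' : Finset V) :
    Set Γ.CliqueVertex :=
  {x | U ⊆ x.type ∧ x.type ⊆ U' ∧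
    x.coset = g • (Γ.standardSubgroup x.type : Set Γ.ArtinGroup)}

theorem smul_standardSubgroup_eq (Γ : DefiningGraph V) {g h : Γ.ArtinGroup} {U T : Finset V}
    (hUT : U ⊆ T)
    (e : g • (Γ.standardSubgroup U : Set Γ.ArtinGroup) = h • (Γ.standardSubgroup U : Set _)) :
    g • (Γ.standardSubgroup T : Set Γ.ArtinGroup) = h • (Γ.standardSubgroup T : Set _) := by
  rw [leftCoset_eq_iff] at e ⊢
  exact Γ.standardSubgroup_mono hUT e

/-- The clique-cube complex `C_Γ`.  Its cubes are the `[g A_U, g A_U']`, of dimension `#(U' \ U)`,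
for `g ∈ A_Γ` and `U ⊆ U'` such that `U'` is empty or spans a clique. -/
def cliqueCubeComplex (Γ : DefiningGraph V) : CubeComplex Γ.CliqueVertex where
  IsCube Q := ∃ (g : Γ.ArtinGroup) (U U' : Finset V), U ⊆ U' ∧ Γ.graph.IsClique (U' : Set V) ∧
    Q = Γ.cliqueCube g U U'
  isCube_singleton x := by
    obtain ⟨g, hg⟩ := x.exists_rep
    refine ⟨g, x.type, x.type, subset_rfl, x.isClique, ?_⟩
    ext y
    constructor
    · rintro rfl
      exact ⟨subset_rfl, subset_rfl, hg⟩
    · rintro ⟨h1, h2, h3⟩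
      have h := h2.antisymm h1
      exact CliqueVertex.ext h (by rw [h3, hg, h])
  exists_coordinates := by
    classical
    rintro Q ⟨g, U, U', hU, hU', rfl⟩
    let ι := {w : V // w ∈ U' \ U}
    obtain ⟨T, hT⟩ : ∃ T : (ι → Bool) → Finset V, ∀ a w,
        w ∈ T a ↔ w ∈ U' ∧ ∀ h : w ∈ U' \ U, a ⟨w, h⟩ = true :=
      ⟨fun a => U'.filter fun w => ∀ h : w ∈ U' \ U, a ⟨w, h⟩ = true, fun a w => Finset.mem_filter⟩
    have hT1 : ∀ a, U ⊆ T a := fun a w hw =>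
      (hT a w).2 ⟨hU hw, fun h => absurd hw (Finset.mem_sdiff.1 h).2⟩
    have hT2 : ∀ a, T a ⊆ U' := fun a w hw => ((hT a w).1 hw).1
    have hTm : ∀ a (i : ι), i.1 ∈ T a ↔ a i = true := fun a i =>
      ⟨fun h => ((hT a i.1).1 h).2 i.2,
        fun h => (hT a i.1).2 ⟨(Finset.mem_sdiff.1 i.2).1, fun _ => h⟩⟩
    have hTs : ∀ S : Finset V, U ⊆ S → S ⊆ U' → T (fun i => decide (i.1 ∈ S)) = S := by
      intro S h1 h2
      ext w
      by_cases hw : w ∈ U' \ U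
      · simpa using hTm (fun i => decide (i.1 ∈ S)) ⟨w, hw⟩
      · by_cases hwU : w ∈ U
        · exact ⟨fun _ => h1 hwU, fun _ => hT1 _ hwU⟩
        · have : w ∉ U' := fun h => hw (Finset.mem_sdiff.2 ⟨h, hwU⟩)
          exact ⟨fun h => absurd (hT2 _ h) this, fun h => absurd (h2 h) this⟩
    let f : (ι → Bool) → Γ.CliqueVertex := fun a =>
      ⟨T a, g • (Γ.standardSubgroup (T a) : Set Γ.ArtinGroup),
        hU'.subset (Finset.coe_subset.2 (hT2 a)), ⟨g, rfl⟩⟩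
    have hfs : ∀ x ∈ Γ.cliqueCube g U U', f (fun i => decide (i.1 ∈ x.type)) = x := by
      rintro x ⟨h1, h2, h3⟩
      have h := hTs x.type h1 h2
      exact CliqueVertex.ext h (by rw [h3]; simp only [f, h])
    have key : IsCubeWithCoordinates (fun Q => ∃ (g : Γ.ArtinGroup) (U U' : Finset V), U ⊆ U' ∧
        Γ.graph.IsClique (U' : Set V) ∧ Q = Γ.cliqueCube g U U') ι (Γ.cliqueCube g U U') := by
      refine ⟨f, fun a b hab => ?_, ?_, fun R hR => ⟨?_, ?_⟩⟩
      · have h : T a = T b := congrArg CliqueVertex.type hab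
        ext i
        rw [Bool.eq_iff_iff, ← hTm, ← hTm, h]
      · ext x
        constructor
        · rintro ⟨a, rfl⟩
          exact ⟨hT1 a, hT2 a, rfl⟩
        · exact fun hx => ⟨_, hfs x hx⟩
      · rintro ⟨h, S, S', hS, hS', rfl⟩
        have m1 := hR (show (⟨S, h • (Γ.standardSubgroup S : Set Γ.ArtinGroup),
          hS'.subset (Finset.coe_subset.2 hS), ⟨h, rfl⟩⟩ : Γ.CliqueVertex) ∈ _ from
            ⟨subset_rfl, hS, rfl⟩)
        have m2 := hR (show (⟨S', h • (Γ.standardSubgroup S' : Set Γ.ArtinGroup),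
          hS', ⟨h, rfl⟩⟩ : Γ.CliqueVertex) ∈ _ from ⟨hS, subset_rfl, rfl⟩)
        have hUS : U ⊆ S := m1.1
        have hSU : S' ⊆ U' := m2.2.1
        have hgh : h • (Γ.standardSubgroup S : Set Γ.ArtinGroup) = g • _ := m1.2.2
        refine ⟨_, ⟨{i | i.1 ∈ S ∨ i.1 ∉ S'}, fun i => decide (i.1 ∈ S), rfl⟩, ?_⟩
        ext x
        constructor
        · rintro ⟨a, ha, rfl⟩
          have e1 : S ⊆ T a := by
            intro w hw
            by_cases hwU : w ∈ U
            · exact hT1 a hwU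
            · have hw' : w ∈ U' \ U := Finset.mem_sdiff.2 ⟨hSU (hS hw), hwU⟩
              refine (hTm a ⟨w, hw'⟩).2 ?_
              rw [ha ⟨w, hw'⟩ (Or.inl hw)]
              simpa using hw
          have e2 : T a ⊆ S' := by
            intro w hw
            by_contra hwS
            have hw' : w ∈ U' \ U := Finset.mem_sdiff.2 ⟨hT2 a hw, fun h => hwS (hS (hUS h))⟩
            have h1 := (hTm a ⟨w, hw'⟩).1 hw
            rw [ha ⟨w, hw'⟩ (Or.inr hwS)] at h1
            exact hwS (hS (by simpa using h1))
          exact ⟨e1, e2, (Γ.smul_standardSubgroup_eq e1 hgh).symm⟩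
        · intro hx
          refine ⟨_, ?_, hfs x (hR hx)⟩
          intro i hi
          rw [Bool.eq_iff_iff]
          simp only [decide_eq_true_eq]
          exact ⟨fun h => hi.resolve_right (not_not.2 (hx.2.1 h)), fun h => hx.1 h⟩
      · rintro ⟨F, ⟨s, a, rfl⟩, rfl⟩
        refine ⟨g, T fun i => decide (i ∈ s ∧ a i = true), T fun i => decide (i ∈ s → a i = true),
          ?_, hU'.subset (Finset.coe_subset.2 (hT2 _)), ?_⟩
        · intro w hw
          have hw1 := (hT _ w).1 hw
          refine (hT _ w).2 ⟨hw1.1, fun h => ?_⟩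
          have := hw1.2 h
          simp only [decide_eq_true_eq] at this ⊢
          exact fun _ => this.2
        · ext x
          constructor
          · rintro ⟨b, hb, rfl⟩
            refine ⟨fun w hw => ?_, fun w hw => ?_, rfl⟩
            · have hw1 := (hT _ w).1 hw
              refine (hT _ w).2 ⟨hw1.1, fun h => ?_⟩
              have := hw1.2 h
              simp only [decide_eq_true_eq] at this
              rw [hb _ this.1, this.2]
            · have hw1 := (hT _ w).1 hw
              refine (hT _ w).2 ⟨hw1.1, fun h => ?_⟩
              simp only [decide_eq_true_eq]
              intro hs
              rw [← hb _ hs]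
              exact hw1.2 h
          · rintro ⟨h1, h2, h3⟩
            refine ⟨_, ?_, hfs x ⟨(hT1 _).trans h1, h2.trans (hT2 _), h3⟩⟩
            intro i hi
            rw [Bool.eq_iff_iff]
            simp only [decide_eq_true_eq]
            constructor
            · intro h
              have := (hTm _ i).1 (h2 h)
              simp only [decide_eq_true_eq] at this
              exact this hi
            · intro h
              exact h1 ((hTm _ i).2 (by simp [hi, h]))
    exact key.exists_fin

end DefiningGraph

/-! In a product of cube complexes each edge runs in the direction of one of the factors, and two
edges at a vertex in different directions span a square. In `C_Γ` the edges at `g A_∅` correspond to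
the generators `s ∈ V`, their other ends being the `g A_{s}`.

Suppose that `C_Γ` is a product and that both directions occur at some `g A_∅`. The directions then
partition `V` into two nonempty classes, and generators `s`, `t` of different classes are joined by
an edge with label 2 (`adj_and_label_eq_two_of_iso`). They are joined because of the square at `g
A_∅`, whose opposite corner is `g A_{s,t}`. For the label, note that a cube has at most one vertex
of each type (`eq_of_mem_of_type_eq`), so that the edges from `g A_{s,t}` to the various `g k A_{s}`
all have the same direction. Each of them therefore spans a square with the edge to `g A_{t}`, so
the cosets `g k A_{s}` and `g A_{t}` meet and `k ∈ ⟨t⟩⟨s⟩`. For `k = s t` and a label at least 3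
this is refuted by the reflection representation (`gen_mul_gen_ne_zpow_mul_zpow`).

If instead only one direction occurs at each `g A_∅`, it is the same for all `g`, because
neighbouring `g A_∅` share some `g A_{s}`. Then the other factor is a point
(`exists_snd_ne_of_iso`).

Conversely, a join with all labels 2 gives `A_Γ = A_Γ' × A_Γ''` with `A_U × A_T` corresponding to
`A_{U ∪ T}`. Hence cosets and cubes correspond as well (`prodIso`). -/

/-! ### Braid relations between reflections. -/

theorem map_alternatingProduct {G : Type u} {H : Type v} [Group G] [Group H] (φ : G →* H) (a b : G)
    (n : ℕ) : φ (alternatingProduct a b n) = alternatingProduct (φ a) (φ b) n := by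
  induction n generalizing a b with
  | zero => simp [alternatingProduct]
  | succ n ih => simp [alternatingProduct, ih]

/-- Inverting an alternating word in involutions just reverses it, so the two sides of a braid
relation of length `n` differ by `(a * b) ^ n`. Thus the Coxeter relation implies the Artin
relation. -/
theorem alternatingProduct_eq_pow_mul {G : Type u} [Group G] {a b : G} (ha : a * a = 1)
    (hb : b * b = 1) (n : ℕ) :
    alternatingProduct a b n = (a * b) ^ n * alternatingProduct b a n := by
  induction n generalizing a b with
  | zero => simp [alternatingProduct]
  | succ n ih =>
    have h : a * (b * a) ^ n = (a * b) ^ n * a := by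
      clear ih
      induction n with
      | zero => simp
      | succ n ihn => rw [pow_succ, ← mul_assoc, ihn, pow_succ]; simp only [mul_assoc]
    calc alternatingProduct a b (n + 1) = a * ((b * a) ^ n * alternatingProduct a b n) := by
          rw [alternatingProduct, ← ih hb ha]
      _ = (a * b) ^ n * (a * ((b * b) * alternatingProduct a b n)) := by
          rw [← mul_assoc, h, hb, one_mul, mul_assoc]
      _ = (a * b) ^ (n + 1) * alternatingProduct b a (n + 1) := by
          rw [alternatingProduct, pow_succ]; simp only [mul_assoc]

theorem alternatingProduct_comm_of_pow_eq_one {G : Type u} [Group G] {a b : G} (ha : a * a = 1)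
    (hb : b * b = 1) {n : ℕ} (h : (a * b) ^ n = 1) :
    alternatingProduct a b n = alternatingProduct b a n := by
  rw [alternatingProduct_eq_pow_mul ha hb, h, one_mul]

open Polynomial.Chebyshev in
/-- Two reflections with Cartan integers `f y * g x = 4 cos² (π / m)` satisfy `(r₁ r₂) ^ m = 1`. -/
theorem Module.reflection_mul_reflection_pow_eq_one {M : Type*} [AddCommGroup M] [Module ℝ M]
    {x y : M} {f g : Module.Dual ℝ M} (hf : f x = 2) (hg : g y = 2) {m : ℕ} (hm : 2 ≤ m)
    (hfy : f y = -2 * Real.cos (Real.pi / m)) (hgx : g x = -2 * Real.cos (Real.pi / m)) :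
    (Module.reflection hf * Module.reflection hg) ^ m = 1 := by
  ext z
  have ht : 2 * Real.cos (2 * (Real.pi / m)) = f y * g x - 2 := by
    rw [hfy, hgx, Real.cos_two_mul]; ring
  -- This expands the power with coefficients that are Chebyshev polynomials `S` evaluated at `2 cos
  -- 2θ`, where `θ = π / m`. They are shown to vanish by means of `S_n(2 cos 2θ) sin 2θ = sin ((n +
  -- 1) 2θ)`. The case `m = 2` is separate, since there `sin 2θ = 0`.
  rw [Module.reflection_mul_reflection_pow_apply hf hg m z _ ht]
  simp only [LinearEquiv.coe_one, id_eq]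
  obtain rfl | hm3 := hm.eq_or_lt
  · have h0 : Real.cos (Real.pi / ((2 : ℕ) : ℝ)) = 0 := by simp
    have h1 : 2 * Real.cos (2 * (Real.pi / ((2 : ℕ) : ℝ))) = -2 := by
      rw [Real.cos_two_mul, h0]; norm_num
    rw [h1, hfy, hgx, h0]
    norm_num
    module
  · have hm0 : (m : ℝ) ≠ 0 := by positivity
    have hmπ : (m : ℝ) * (Real.pi / m) = Real.pi := by field_simp
    have hsin : Real.sin (2 * (Real.pi / m)) ≠ 0 := by
      have h3 : (3 : ℝ) ≤ m := by exact_mod_cast hm3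
      apply ne_of_gt
      apply Real.sin_pos_of_pos_of_lt_pi
      · positivity
      · rw [← mul_div_assoc, div_lt_iff₀ (by linarith)]
        nlinarith [Real.pi_pos]
    rcases Nat.even_or_odd' m with ⟨k, hk | hk⟩
    -- For `m = 2k` both coefficients contain `S_{k-1}`, which is killed by `sin (k · 2θ) = sin π =
    -- 0`.
    · have e1 : ((m : ℤ) - 1) / 2 = k - 1 := by omega
      have e2 : ((m : ℤ) - 2) / 2 = k - 1 := by omega
      have hS : (S ℝ ((k : ℤ) - 1)).eval (2 * Real.cos (2 * (Real.pi / m))) = 0 := by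
        apply (mul_eq_zero.1 _).resolve_right hsin
        rw [S_two_mul_real_cos]
        push_cast
        rw [show ((k : ℝ) - 1 + 1) * (2 * (Real.pi / m)) = ((2 * k : ℕ) : ℝ) * (Real.pi / m) by
          push_cast; ring, ← hk, hmπ, Real.sin_pi]
      rw [e1, e2, hS]
      simp
    · have e1 : ((m : ℤ) - 1) / 2 = k := by omega
      have e2 : ((m : ℤ) - 2) / 2 = k - 1 := by omega
      have e3 : ((m : ℤ) - 3) / 2 = k - 1 := by omega
      have e4 : (m : ℤ) / 2 = k := by omega
      -- For `m = 2k + 1` both coefficients contain `S_k + S_{k-1}`, which vanishes because `sin (π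
      -- + θ) + sin (π - θ) = 0`.
      have hS : (S ℝ (k : ℤ)).eval (2 * Real.cos (2 * (Real.pi / m))) +
          (S ℝ ((k : ℤ) - 1)).eval (2 * Real.cos (2 * (Real.pi / m))) = 0 := by
        apply (mul_eq_zero.1 _).resolve_right hsin
        rw [add_mul, S_two_mul_real_cos, S_two_mul_real_cos]
        push_cast
        have hk' : (m : ℝ) = 2 * k + 1 := by rw [hk]; push_cast; ring
        rw [show ((k : ℝ) + 1) * (2 * (Real.pi / m)) = Real.pi / m + Real.pi by
          linear_combination hmπ - hk' * (Real.pi / m),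
          show ((k : ℝ) - 1 + 1) * (2 * (Real.pi / m)) = Real.pi - Real.pi / m by
          linear_combination hmπ - hk' * (Real.pi / m), Real.sin_add_pi, Real.sin_pi_sub]
        ring
      rw [e1, e2, e3, e4, hS]
      simp

/-! ### Homomorphisms from Artin groups and the reflection representation. -/

namespace DefiningGraph

variable {V : Type u}

/-- The generator of the Artin group given by a vertex. -/
abbrev gen (Γ : DefiningGraph V) (s : V) : Γ.ArtinGroup := PresentedGroup.of s

theorem alternatingProduct_gen_comm (Γ : DefiningGraph V) {s t : V} (h : Γ.graph.Adj s t) :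
    alternatingProduct (Γ.gen s) (Γ.gen t) (Γ.label s(s, t)) =
      alternatingProduct (Γ.gen t) (Γ.gen s) (Γ.label s(s, t)) := by
  have := PresentedGroup.one_of_mem (rels := Γ.artinRelators) ⟨s, t, h, rfl⟩
  rw [map_mul, map_inv, map_alternatingProduct, map_alternatingProduct, mul_inv_eq_one] at this
  exact this

/-- A homomorphism from the Artin group, given by its values on the generators. -/
def liftArtin (Γ : DefiningGraph V) {G : Type v} [Group G] (f : V → G)
    (hf : ∀ s t, Γ.graph.Adj s t → alternatingProduct (f s) (f t) (Γ.label s(s, t)) =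
      alternatingProduct (f t) (f s) (Γ.label s(s, t))) : Γ.ArtinGroup →* G :=
  PresentedGroup.toGroup (f := f) (by
    rintro _ ⟨s, t, h, rfl⟩
    rw [map_mul, map_inv, map_alternatingProduct, map_alternatingProduct, mul_inv_eq_one]
    simpa using hf s t h)

@[simp]
theorem liftArtin_gen (Γ : DefiningGraph V) {G : Type v} [Group G] (f : V → G) (hf) (s : V) :
    Γ.liftArtin f hf (Γ.gen s) = f s :=
  PresentedGroup.toGroup.of _

open Classical in
/-- The entries of the Gram matrix (scaled by `2`) of the reflection representation. -/
noncomputable def gramEntry (Γ : DefiningGraph V) (s t : V) : ℝ :=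
  if s = t then 2 else
    -- Non-adjacent pairs satisfy no relation, so any value would do for them; `0` is the simplest.
    if Γ.graph.Adj s t then -2 * Real.cos (Real.pi / Γ.label s(s, t)) else 0

/-- The coroot of a vertex in the reflection representation. -/
noncomputable def coroot (Γ : DefiningGraph V) (s : V) : Module.Dual ℝ (V →₀ ℝ) :=
  Finsupp.linearCombination ℝ (Γ.gramEntry s)

theorem coroot_single (Γ : DefiningGraph V) (s t : V) (a : ℝ) :
    Γ.coroot s (Finsupp.single t a) = a * Γ.gramEntry s t := by
  simp [coroot]

theorem gramEntry_self (Γ : DefiningGraph V) (s : V) : Γ.gramEntry s s = 2 := by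
  simp [gramEntry]

theorem coroot_single_self (Γ : DefiningGraph V) (s : V) :
    Γ.coroot s (Finsupp.single s 1) = 2 := by
  rw [coroot_single, gramEntry_self, one_mul]

theorem gramEntry_of_adj (Γ : DefiningGraph V) {s t : V} (h : Γ.graph.Adj s t) :
    Γ.gramEntry s t = -2 * Real.cos (Real.pi / Γ.label s(s, t)) := by
  simp [gramEntry, h.ne, h]

/-- The reflection representation of the Artin group (which factors through the Coxeter group). -/
noncomputable def reflectionRep (Γ : DefiningGraph V) :
    Γ.ArtinGroup →* ((V →₀ ℝ) ≃ₗ[ℝ] (V →₀ ℝ)) :=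
  Γ.liftArtin (fun s => Module.reflection (Γ.coroot_single_self s)) fun s t h => by
    refine alternatingProduct_comm_of_pow_eq_one ?_ ?_ ?_
    · rw [mul_eq_one_iff_eq_inv, Module.reflection_inv]
    · rw [mul_eq_one_iff_eq_inv, Module.reflection_inv]
    · refine Module.reflection_mul_reflection_pow_eq_one _ _ (Γ.two_le_label _ h) ?_ ?_
      · rw [coroot_single, one_mul, gramEntry_of_adj _ h]
      · rw [coroot_single, one_mul, gramEntry_of_adj _ h.symm, Sym2.eq_swap]

theorem reflectionRep_gen (Γ : DefiningGraph V) (s : V) :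
    Γ.reflectionRep (Γ.gen s) = Module.reflection (Γ.coroot_single_self s) :=
  Γ.liftArtin_gen _ _ s

theorem reflectionRep_gen_mul_self (Γ : DefiningGraph V) (s : V) :
    Γ.reflectionRep (Γ.gen s) * Γ.reflectionRep (Γ.gen s) = 1 := by
  rw [reflectionRep_gen, mul_eq_one_iff_eq_inv, Module.reflection_inv]

theorem reflectionRep_gen_zpow (Γ : DefiningGraph V) (s : V) (i : ℤ) :
    Γ.reflectionRep (Γ.gen s) ^ i = 1 ∨
      Γ.reflectionRep (Γ.gen s) ^ i = Γ.reflectionRep (Γ.gen s) := by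
  have h2 : Γ.reflectionRep (Γ.gen s) ^ (2 : ℤ) = 1 := by
    rw [zpow_two, reflectionRep_gen_mul_self]
  rcases Int.even_or_odd' i with ⟨k, rfl | rfl⟩
  · left; rw [zpow_mul, h2, one_zpow]
  · right; rw [zpow_add, zpow_mul, h2, one_zpow, one_mul, zpow_one]

/-- If the edge joining `s` and `t` has label at least `3`, then `s * t` is not a product of a power
of `t` and a power of `s`. -/
theorem gen_mul_gen_ne_zpow_mul_zpow (Γ : DefiningGraph V) {s t : V} (h : Γ.graph.Adj s t)
    (hl : 3 ≤ Γ.label s(s, t)) (i j : ℤ) :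
    Γ.gen s * Γ.gen t ≠ Γ.gen t ^ i * Γ.gen s ^ j := by
  intro heq
  set c : ℝ := Γ.gramEntry s t with hc
  have hc' : Γ.gramEntry t s = c := by
    rw [hc, gramEntry_of_adj _ h, gramEntry_of_adj _ h.symm, Sym2.eq_swap]
  have hc0 : c ≠ 0 := by
    rw [hc, gramEntry_of_adj _ h]
    have h3 : (3 : ℝ) ≤ Γ.label s(s, t) := by exact_mod_cast hl
    have : 0 < Real.cos (Real.pi / Γ.label s(s, t)) := by
      apply Real.cos_pos_of_mem_Ioo
      constructor
      · have : 0 < Real.pi / Γ.label s(s, t) := by positivity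
        linarith [Real.pi_pos]
      · rw [div_lt_div_iff₀ (by linarith) (by norm_num)]
        nlinarith [Real.pi_pos]
    simpa using this.ne'
  have hs : ∀ z : V →₀ ℝ, Γ.reflectionRep (Γ.gen s) z =
      z - Γ.coroot s z • Finsupp.single s 1 := fun z => by
    rw [reflectionRep_gen, Module.reflection_apply]
  have ht : ∀ z : V →₀ ℝ, Γ.reflectionRep (Γ.gen t) z =
      z - Γ.coroot t z • Finsupp.single t 1 := fun z => by
    rw [reflectionRep_gen, Module.reflection_apply]
  have key := congrArg Γ.reflectionRep heq
  rw [map_mul, map_mul, map_zpow, map_zpow] at key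
  have k2 := DFunLike.congr_fun key (Finsupp.single t (1 : ℝ))
  have k3 := DFunLike.congr_fun key (Finsupp.single s (1 : ℝ))
  -- The left side maps `e_t` to `c e_s - e_t`, with `e_s`-coordinate `c`. Each of the four possible
  -- right sides gives `0` or `-c` instead, while `c ≠ 0`.
  have a1 := DFunLike.congr_fun k2 s
  have a3 := DFunLike.congr_fun k3 s
  rcases Γ.reflectionRep_gen_zpow t i with hi | hi <;>
    rcases Γ.reflectionRep_gen_zpow s j with hj | hj <;>
    rw [hi, hj] at a1 a3 <;>
    simp [hs, ht, coroot_single, gramEntry_self, ← hc, hc', h.ne, hc0] at a1 a3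
  all_goals exact hc0 (by linarith)

end DefiningGraph

/-! ### Edges and squares in a product of cube complexes. -/

namespace CubeComplex

variable {α β γ : Type*} {X : CubeComplex α} {Y : CubeComplex β} {Z : CubeComplex γ}

/-- The first coordinate of a vertex of a complex which is identified with a product. -/
def Iso.fst (φ : Iso (Y.prod Z) X) (x : α) : β := (φ.toEquiv.symm x).1

/-- The second coordinate of a vertex of a complex which is identified with a product. -/
def Iso.snd (φ : Iso (Y.prod Z) X) (x : α) : γ := (φ.toEquiv.symm x).2

theorem Iso.eq_of_fst_eq_of_snd_eq (φ : Iso (Y.prod Z) X) {x y : α} (h1 : φ.fst x = φ.fst y)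
    (h2 : φ.snd x = φ.snd y) : x = y :=
  φ.toEquiv.symm.injective (Prod.ext h1 h2)

theorem Iso.exists_fst_snd (φ : Iso (Y.prod Z) X) (b : β) (c : γ) :
    ∃ x, φ.fst x = b ∧ φ.snd x = c :=
  ⟨φ.toEquiv (b, c), by simp [Iso.fst], by simp [Iso.snd]⟩

/-- This describes cubes of `X` by the two coordinates of their vertices, so that later arguments
need not transport sets along `φ`. -/
theorem Iso.isCube_iff_exists (φ : Iso (Y.prod Z) X) (Q : Set α) :
    X.IsCube Q ↔ ∃ A B, Y.IsCube A ∧ Z.IsCube B ∧ ∀ x, x ∈ Q ↔ φ.fst x ∈ A ∧ φ.snd x ∈ B := by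
  have h := φ.isCube_iff (φ.toEquiv.symm '' Q)
  rw [Set.image_image] at h
  simp only [Equiv.apply_symm_apply, Set.image_id'] at h
  rw [← h]
  refine exists_congr fun A => exists_congr fun B =>
    and_congr_right fun _ => and_congr_right fun _ => ?_
  rw [Equiv.image_eq_preimage_symm, Equiv.symm_symm, Set.ext_iff, φ.toEquiv.forall_congr_left]
  simp [Iso.fst, Iso.snd, Set.mem_prod]

/-- Along an edge of a product, one of the coordinates is constant. -/
theorem Iso.eq_or_eq_of_isCube_pair (φ : Iso (Y.prod Z) X) {x y : α} (h : X.IsCube {x, y}) :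
    φ.fst x = φ.fst y ∨ φ.snd x = φ.snd y := by
  obtain ⟨A, B, -, -, h⟩ := (φ.isCube_iff_exists _).1 h
  have hx := (h x).1 (by simp)
  have hy := (h y).1 (by simp)
  -- A product set contains the vertex with mixed coordinates, and here it can only be `x` or `y`.
  obtain ⟨z, h1, h2⟩ := φ.exists_fst_snd (φ.fst x) (φ.snd y)
  rcases (h z).2 ⟨h1 ▸ hx.1, h2 ▸ hy.2⟩ with rfl | rfl
  · exact Or.inr h2
  · exact Or.inl h1.symm

theorem Iso.isCube_fst_pair (φ : Iso (Y.prod Z) X) {x y : α} (h : X.IsCube {x, y}) :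
    Y.IsCube {φ.fst x, φ.fst y} := by
  obtain ⟨A, B, hA, -, h⟩ := (φ.isCube_iff_exists _).1 h
  have hx := (h x).1 (by simp)
  have hy := (h y).1 (by simp)
  suffices A = {φ.fst x, φ.fst y} from this ▸ hA
  ext a
  constructor
  · intro ha
    obtain ⟨z, h1, h2⟩ := φ.exists_fst_snd a (φ.snd x)
    rcases (h z).2 ⟨h1 ▸ ha, h2 ▸ hx.2⟩ with rfl | rfl <;> simp [h1]
  · rintro (rfl | rfl)
    exacts [hx.1, hy.1]

theorem Iso.isCube_snd_pair (φ : Iso (Y.prod Z) X) {x y : α} (h : X.IsCube {x, y}) :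
    Z.IsCube {φ.snd x, φ.snd y} := by
  obtain ⟨A, B, -, hB, h⟩ := (φ.isCube_iff_exists _).1 h
  have hx := (h x).1 (by simp)
  have hy := (h y).1 (by simp)
  suffices B = {φ.snd x, φ.snd y} from this ▸ hB
  ext b
  constructor
  · intro hb
    obtain ⟨z, h1, h2⟩ := φ.exists_fst_snd (φ.fst x) b
    rcases (h z).2 ⟨h1 ▸ hx.1, h2 ▸ hb⟩ with rfl | rfl <;> simp [h2]
  · rintro (rfl | rfl)
    exacts [hx.2, hy.2]

/-- Two edges at a vertex of a product in the directions of different factors span a square. -/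
theorem Iso.exists_square (φ : Iso (Y.prod Z) X) {x y z : α} (hy : X.IsCube {x, y})
    (hz : X.IsCube {x, z}) (hxy : φ.snd x = φ.snd y) (hxz : φ.fst x = φ.fst z) :
    ∃ w, φ.fst w = φ.fst y ∧ φ.snd w = φ.snd z ∧ X.IsCube {x, y, z, w} := by
  obtain ⟨w, h1, h2⟩ := φ.exists_fst_snd (φ.fst y) (φ.snd z)
  refine ⟨w, h1, h2, (φ.isCube_iff_exists _).2
    ⟨_, _, φ.isCube_fst_pair hy, φ.isCube_snd_pair hz, fun a => ⟨?_, ?_⟩⟩⟩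
  · rintro (rfl | rfl | rfl | rfl) <;> simp [*]
  · rintro ⟨ha | ha, hb | hb⟩
    · exact Or.inl (φ.eq_of_fst_eq_of_snd_eq ha hb)
    · exact Or.inr (Or.inr (Or.inl (φ.eq_of_fst_eq_of_snd_eq (ha.trans hxz) hb)))
    · exact Or.inr (Or.inl (φ.eq_of_fst_eq_of_snd_eq ha (hb.trans hxy)))
    · exact Or.inr (Or.inr (Or.inr (φ.eq_of_fst_eq_of_snd_eq (ha.trans h1.symm) (hb.trans h2.symm))))

/-- Changing a single coordinate in which `x` and `y` differ leads from `x` along an edge of the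
cube. -/
theorem exists_isCube_pair (X : CubeComplex α) {Q : Set α} (hQ : X.IsCube Q) {x y : α} (hx : x ∈ Q)
    (hy : y ∈ Q) (hxy : x ≠ y) : ∃ z, x ≠ z ∧ X.IsCube {x, z} := by
  obtain ⟨n, f, hf, rfl, hc⟩ := X.exists_coordinates Q hQ
  obtain ⟨a, rfl⟩ := hx
  obtain ⟨b, rfl⟩ := hy
  obtain ⟨i, hi⟩ : ∃ i, a i ≠ b i := by
    by_contra! h
    exact hxy (congrArg f (funext h))
  refine ⟨f (Function.update a i (b i)), fun h => hi ?_, ?_⟩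
  · simpa using congrFun (hf h) i
  · refine (hc _ ?_).2 ⟨_, ⟨{i}ᶜ, a, rfl⟩, ?_⟩
    · rintro _ (rfl | rfl) <;> exact Set.mem_range_self _
    · rw [← Set.image_pair]
      congr 1
      ext c
      constructor
      · intro h
        by_cases hci : c i = a i
        · left
          ext j
          by_cases hj : j = i
          · rw [hj, hci]
          · rw [h j hj]
        · right
          ext j
          by_cases hj : j = i
          · subst hj
            simp only [Function.update_self]
            revert hci hi
            cases c j <;> cases a j <;> cases b j <;> simp
          · rw [h j hj, Function.update_of_ne hj]
      · rintro (rfl | rfl) j hj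
        · rfl
        · exact Function.update_of_ne hj _ _

/-- If all the edges of a cube at the vertex `x` have constant second coordinate, then so has the
whole cube. -/
theorem Iso.snd_eq_of_isCube (φ : Iso (Y.prod Z) X) {x y : α} {Q : Set α} (hQ : X.IsCube Q)
    (hx : x ∈ Q) (hy : y ∈ Q)
    (h : ∀ z, X.IsCube {x, z} → φ.snd x = φ.snd z) : φ.snd y = φ.snd x := by
  obtain ⟨A, B, -, hB, hAB⟩ := (φ.isCube_iff_exists _).1 hQ
  by_contra hne
  -- If the second coordinate varied on `Q`, the second factor of `Q` would have an edge at `φ.snd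
  -- x`, and this lifts to an edge at `x`.
  obtain ⟨c, hc, hcube⟩ :=
    Z.exists_isCube_pair hB ((hAB x).1 hx).2 ((hAB y).1 hy).2 (Ne.symm hne)
  obtain ⟨z, h1, h2⟩ := φ.exists_fst_snd (φ.fst x) c
  refine hc ((h z ((φ.isCube_iff_exists _).2
    ⟨_, _, Y.isCube_singleton (φ.fst x), hcube, fun a => ⟨?_, ?_⟩⟩)).trans h2)
  · rintro (rfl | rfl) <;> simp [h1, h2]
  · rintro ⟨ha, hb | hb⟩
    · exact Or.inl (φ.eq_of_fst_eq_of_snd_eq ha hb)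
    · exact Or.inr (φ.eq_of_fst_eq_of_snd_eq (ha.trans h1.symm) (hb.trans h2.symm))

/-- Exchange the two factors of a product. -/
def Iso.swap (φ : Iso (Y.prod Z) X) : Iso (Z.prod Y) X where
  toEquiv := (Equiv.prodComm γ β).trans φ.toEquiv
  isCube_iff Q := by
    rw [Equiv.coe_trans, Set.image_comp, ← φ.isCube_iff]
    constructor
    · rintro ⟨B, A, hB, hA, rfl⟩
      exact ⟨A, B, hA, hB, Set.image_swap_prod _ _⟩
    · rintro ⟨A, B, hA, hB, h⟩
      refine ⟨B, A, hB, hA, ?_⟩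
      rw [← Set.image_swap_prod, ← h]
      exact (Set.image_image _ _ _).trans (by simp) |>.symm

end CubeComplex

/-! ### Reducibility of the defining graph and connectedness of `Γ^t`. -/

namespace DefiningGraph

variable {V : Type u}

/-- The two subgraphs are necessarily those induced on a set and its complement, so the set alone
carries the information. -/
theorem isReducible_iff_exists_set (Γ : DefiningGraph V) :
    Γ.IsReducible ↔ ∃ S : Set V, S.Nonempty ∧ Sᶜ.Nonempty ∧
      ∀ s ∈ S, ∀ t ∉ S, Γ.graph.Adj s t ∧ Γ.label s(s, t) = 2 := by
  constructor
  · rintro ⟨Γ', Γ'', h⟩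
    have hc : Γ'.vertsᶜ = Γ''.verts :=
      (isCompl_iff.2 ⟨h.disjoint, codisjoint_iff.2 h.union_eq⟩).compl_eq
    refine ⟨Γ'.verts, h.nonempty_left, hc ▸ h.nonempty_right, fun s hs t ht => ?_⟩
    have ht' : t ∈ Γ''.verts := hc ▸ ht
    exact ⟨(h.adj_iff s t).2 (Or.inr (Or.inr (Or.inl ⟨hs, ht'⟩))), h.label_eq_two s hs t ht'⟩
  · rintro ⟨S, hS, hS', h⟩
    refine ⟨(⊤ : Γ.graph.Subgraph).induce S, (⊤ : Γ.graph.Subgraph).induce Sᶜ, hS, hS',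
      disjoint_compl_right, Set.union_compl_self S, fun s t => ?_, fun s hs t ht => (h s hs t ht).2⟩
    simp only [SimpleGraph.Subgraph.induce_adj, SimpleGraph.Subgraph.induce_verts,
      SimpleGraph.Subgraph.top_adj, Set.mem_compl_iff]
    have h1 := fun hs ht => (h s hs t ht).1
    have h2 := fun ht hs => (h t ht s hs).1.symm
    tauto

/-- Distinct vertices are non-adjacent in `Γ^t` exactly if an edge of `Γ` with label 2 joins them.
So a path of `Γ^t` cannot leave a side of a join, and a connected component of `Γ^t` is a possible
side. -/
theorem isReducible_iff_not_preconnected_tGraph (Γ : DefiningGraph V) :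
    Γ.IsReducible ↔ ¬ Γ.tGraph.Preconnected := by
  rw [isReducible_iff_exists_set]
  constructor
  · rintro ⟨S, ⟨s, hs⟩, ⟨t, ht⟩, h⟩ hpre
    obtain ⟨w⟩ := hpre s t
    obtain ⟨d, -, hd, hd'⟩ := w.exists_boundary_dart S hs ht
    obtain ⟨hadj, hlab⟩ := h _ hd _ hd'
    have := d.adj.2 hadj
    omega
  · intro hpre
    unfold SimpleGraph.Preconnected at hpre
    push Not at hpre
    obtain ⟨s, t, hst⟩ := hpre
    refine ⟨{x | Γ.tGraph.Reachable s x}, ⟨s, SimpleGraph.Reachable.refl s⟩, ⟨t, hst⟩,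
      fun x hx y hy => ?_⟩
    have hxy : ¬ Γ.tGraph.Adj x y := fun h => hy (SimpleGraph.Reachable.trans hx h.reachable)
    have hne : x ≠ y := fun h => hy (h ▸ hx)
    have hadj : Γ.graph.Adj x y := by
      by_contra hn
      exact hxy ⟨hne, fun h => absurd h hn⟩
    have h2 := Γ.two_le_label s(x, y) hadj
    have h3 : ¬ 3 ≤ Γ.label s(x, y) := fun h => hxy ⟨hne, fun _ => h⟩
    exact ⟨hadj, by omega⟩

/-! ### Vertices and edges of the clique-cube complex. -/

variable (Γ : DefiningGraph V)

/-- The vertex `g A_U` of the clique-cube complex. -/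
@[simps]
def vertex (g : Γ.ArtinGroup) (U : Finset V) (hU : Γ.graph.IsClique (U : Set V)) :
    Γ.CliqueVertex :=
  ⟨U, g • (Γ.standardSubgroup U : Set Γ.ArtinGroup), hU, ⟨g, rfl⟩⟩

theorem exists_eq_vertex (x : Γ.CliqueVertex) : ∃ g, x = Γ.vertex g x.type x.isClique := by
  obtain ⟨g, hg⟩ := x.exists_rep
  exact ⟨g, CliqueVertex.ext rfl hg⟩

variable {Γ}

theorem vertex_eq_vertex_iff {g h : Γ.ArtinGroup} {U : Finset V}
    {hU hU' : Γ.graph.IsClique (U : Set V)} :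
    Γ.vertex g U hU = Γ.vertex h U hU' ↔ g⁻¹ * h ∈ Γ.standardSubgroup U := by
  rw [CliqueVertex.ext_iff, ← leftCoset_eq_iff]
  simp

theorem vertex_mem_cliqueCube_iff {g h : Γ.ArtinGroup} {T U U' : Finset V}
    {hT : Γ.graph.IsClique (T : Set V)} :
    Γ.vertex g T hT ∈ Γ.cliqueCube h U U' ↔
      U ⊆ T ∧ T ⊆ U' ∧ Γ.vertex g T hT = Γ.vertex h T hT := by
  simp [cliqueCube, CliqueVertex.ext_iff]

theorem mem_cliqueCube_iff {x : Γ.CliqueVertex} {h : Γ.ArtinGroup} {U U' : Finset V} :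
    x ∈ Γ.cliqueCube h U U' ↔ U ⊆ x.type ∧ x.type ⊆ U' ∧ x = Γ.vertex h x.type x.isClique := by
  simp [cliqueCube, CliqueVertex.ext_iff]

theorem vertex_eq_of_subset {g h : Γ.ArtinGroup} {U T : Finset V}
    {hU hU' : Γ.graph.IsClique (U : Set V)} {hT : Γ.graph.IsClique (T : Set V)} (hUT : U ⊆ T)
    (e : Γ.vertex g U hU = Γ.vertex h U hU') : Γ.vertex g T hT = Γ.vertex h T hT := by
  rw [vertex_eq_vertex_iff] at e ⊢
  exact Γ.standardSubgroup_mono hUT e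

/-- All vertices of a cube are cosets `h A_T` with one common `h`. This is what forbids squares
between edges leading to distinct vertices of the same type. -/
theorem eq_of_mem_of_type_eq {Q : Set Γ.CliqueVertex} (hQ : Γ.cliqueCubeComplex.IsCube Q)
    {x y : Γ.CliqueVertex} (hx : x ∈ Q) (hy : y ∈ Q) (h : x.type = y.type) : x = y := by
  obtain ⟨g, U, U', -, -, rfl⟩ := hQ
  exact CliqueVertex.ext h (by rw [hx.2.2, hy.2.2, h])

theorem isCube_pair {g h : Γ.ArtinGroup} {U T : Finset V} {hU : Γ.graph.IsClique (U : Set V)}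
    {hT : Γ.graph.IsClique (T : Set V)} (hUT : U ⩿ T)
    (hgh : Γ.vertex g T hT = Γ.vertex h T hT) :
    Γ.cliqueCubeComplex.IsCube {Γ.vertex g U hU, Γ.vertex h T hT} := by
  refine ⟨g, U, T, hUT.le, hT, ?_⟩
  rw [← hgh]
  ext x
  rw [mem_cliqueCube_iff]
  constructor
  · rintro (rfl | rfl)
    · exact ⟨subset_rfl, hUT.le, rfl⟩
    · exact ⟨hUT.le, subset_rfl, rfl⟩
  · rintro ⟨h1, h2, h3⟩
    rcases hUT.eq_or_eq h1 h2 with h | h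
    · left; rw [h3]; exact CliqueVertex.ext h (by simp [h])
    · right; rw [h3]; exact CliqueVertex.ext h (by simp [h])

theorem isClique_empty : Γ.graph.IsClique ((∅ : Finset V) : Set V) := by simp

theorem isClique_singleton (s : V) : Γ.graph.IsClique (({s} : Finset V) : Set V) := by simp

theorem isClique_pair [DecidableEq V] {s t : V} (h : Γ.graph.Adj s t) :
    Γ.graph.IsClique (({s, t} : Finset V) : Set V) := by
  simpa [SimpleGraph.isClique_pair] using fun _ => h

theorem standardSubgroup_singleton (s : V) :
    Γ.standardSubgroup {s} = Subgroup.zpowers (Γ.gen s) := by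
  simp [standardSubgroup, Subgroup.zpowers_eq_closure]

variable (Γ) in
/-- The vertex `g A_∅`. -/
abbrev vertex₀ (g : Γ.ArtinGroup) : Γ.CliqueVertex := Γ.vertex g ∅ isClique_empty

variable (Γ) in
/-- The vertex `g A_{s}`. -/
abbrev vertex₁ (g : Γ.ArtinGroup) (s : V) : Γ.CliqueVertex := Γ.vertex g {s} (isClique_singleton s)

theorem isCube_vertex₀_vertex₁ (g : Γ.ArtinGroup) (s : V) :
    Γ.cliqueCubeComplex.IsCube {Γ.vertex₀ g, Γ.vertex₁ g s} :=
  isCube_pair (Finset.empty_covBy_singleton s).wcovBy rfl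

/-- A cube containing `g A_∅` has a largest type `U` of vertices, and contains all the `g A_T` with
`T ⊆ U`. -/
theorem vertex_mem_of_vertex₀_mem {Q : Set Γ.CliqueVertex} (hQ : Γ.cliqueCubeComplex.IsCube Q)
    {g : Γ.ArtinGroup} (h0 : Γ.vertex₀ g ∈ Q) :
    ∃ U : Finset V, Γ.graph.IsClique (U : Set V) ∧ (∀ x ∈ Q, x.type ⊆ U) ∧
      ∀ (T : Finset V) (hT : Γ.graph.IsClique (T : Set V)), T ⊆ U → Γ.vertex g T hT ∈ Q := by
  obtain ⟨h, U, U', -, hU', rfl⟩ := hQ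
  refine ⟨U', hU', fun x hx => hx.2.1, fun T hT hTU => ?_⟩
  rw [vertex_mem_cliqueCube_iff] at h0 ⊢
  exact ⟨h0.1.trans (Finset.empty_subset T), hTU,
    vertex_eq_of_subset (Finset.empty_subset T) h0.2.2⟩

/-- A cube containing `g A_∅` and a vertex whose type contains `s` also contains `g A_{s}`, and an
edge has no room for a third vertex. -/
theorem exists_vertex₁_of_isCube_pair {g : Γ.ArtinGroup} {x : Γ.CliqueVertex}
    (h : Γ.cliqueCubeComplex.IsCube {Γ.vertex₀ g, x}) :
    x = Γ.vertex₀ g ∨ ∃ s, x = Γ.vertex₁ g s := by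
  obtain ⟨U, -, hU, hmem⟩ := vertex_mem_of_vertex₀_mem (g := g) h (by simp)
  obtain hx | ⟨s, hs⟩ := x.type.eq_empty_or_nonempty
  · exact Or.inl (eq_of_mem_of_type_eq h (by simp) (by simp) hx)
  · right
    refine ⟨s, ?_⟩
    rcases hmem {s} (isClique_singleton s)
      (Finset.singleton_subset_iff.2 (hU x (by simp) hs)) with h' | h'
    · simpa using congrArg CliqueVertex.type h'
    · exact (Set.mem_singleton_iff.1 h').symm

/-! ### A product decomposition of `C_Γ` yields a join decomposition of `Γ`. -/

section Product

variable {β γ : Type*} {Y : CubeComplex β} {Z : CubeComplex γ}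

/-- If an edge `g A_∅ — g A_{s}` is in the direction of the first factor and an edge
`g A_∅ — g A_{t}` is in the direction of the second one, then `s` and `t` commute. -/
theorem adj_and_label_eq_two_of_iso (φ : CubeComplex.Iso (Y.prod Z) Γ.cliqueCubeComplex)
    {g : Γ.ArtinGroup} {s t : V} (hs : φ.snd (Γ.vertex₀ g) = φ.snd (Γ.vertex₁ g s))
    (ht : φ.fst (Γ.vertex₀ g) = φ.fst (Γ.vertex₁ g t)) :
    Γ.graph.Adj s t ∧ Γ.label s(s, t) = 2 := by
  classical
  have hst : s ≠ t := by
    rintro rfl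
    have := congrArg CliqueVertex.type (φ.eq_of_fst_eq_of_snd_eq ht hs)
    simp at this
  obtain ⟨w, hw1, hw2, hQ⟩ := φ.exists_square (isCube_vertex₀_vertex₁ g s)
    (isCube_vertex₀_vertex₁ g t) hs ht
  obtain ⟨U, hU, hsub, hmem⟩ := vertex_mem_of_vertex₀_mem (g := g) hQ (by simp)
  have hsU : s ∈ U := by simpa using hsub (Γ.vertex₁ g s) (by simp)
  have htU : t ∈ U := by simpa using hsub (Γ.vertex₁ g t) (by simp)
  have hadj : Γ.graph.Adj s t := hU hsU htU hst
  refine ⟨hadj, ?_⟩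
  -- The cube contains `g A_{s,t}`, and the types rule out the three other corners.
  have hy : w = Γ.vertex g {s, t} (isClique_pair hadj) := by
    have hst' : t ∉ ({s} : Finset V) := by simpa using hst.symm
    rcases hmem {s, t} (isClique_pair hadj) (by simp [Finset.insert_subset_iff, hsU, htU])
      with h | h | h | h
    · simpa using congrArg CliqueVertex.type h
    · exact absurd ((congrArg CliqueVertex.type h : ({s, t} : Finset V) = {s}).le (by simp)) hst'
    · have : s ∈ ({t} : Finset V) :=
        (congrArg CliqueVertex.type h : ({s, t} : Finset V) = {t}).le (by simp)
      exact absurd (by simpa using this) hst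
    · exact h.symm
  have hcov1 : ({s} : Finset V) ⩿ {s, t} := by
    rw [Finset.pair_comm]; exact Finset.wcovBy_insert _ _
  have hcov2 : ({t} : Finset V) ⩿ {s, t} := Finset.wcovBy_insert _ _
  by_contra hl
  have hl3 : 3 ≤ Γ.label s(s, t) := by
    have := Γ.two_le_label s(s, t) hadj
    omega
  set k := Γ.gen s * Γ.gen t with hk
  have hkg : Γ.vertex (g * k) {s, t} (isClique_pair hadj) = w := by
    rw [hy, eq_comm, vertex_eq_vertex_iff, inv_mul_cancel_left]
    exact mul_mem (Subgroup.subset_closure ⟨s, by simp, rfl⟩)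
      (Subgroup.subset_closure ⟨t, by simp, rfl⟩)
  have e1 : Γ.cliqueCubeComplex.IsCube {w, Γ.vertex₁ g s} := by
    rw [Set.pair_comm, hy]; exact isCube_pair hcov1 rfl
  have e2 : Γ.cliqueCubeComplex.IsCube {w, Γ.vertex₁ g t} := by
    rw [Set.pair_comm, hy]; exact isCube_pair hcov2 rfl
  have e3 : Γ.cliqueCubeComplex.IsCube {w, Γ.vertex₁ (g * k) s} := by
    rw [Set.pair_comm, ← hkg]; exact isCube_pair hcov1 rfl
  -- The edge from `w` to `g A_{s}` is in the direction of the second factor. An edge from `w` to `g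
  -- k A_{s}` in the other direction would span a square with it, which would have two vertices of
  -- type `{s}`.
  have hfst : φ.fst w = φ.fst (Γ.vertex₁ (g * k) s) := by
    refine (φ.eq_or_eq_of_isCube_pair e3).elim id fun h => ?_
    obtain ⟨v, -, -, hv⟩ := φ.exists_square e3 e1 h hw1
    have : Γ.vertex₁ (g * k) s = Γ.vertex₁ g s :=
      eq_of_mem_of_type_eq hv (by simp) (by simp) rfl
    rw [this, hw1]
  -- The edges from `w` to `g A_{t}` and to `g k A_{s}` have different directions. The base point
  -- `h` of their square lies in both cosets, whence `k = t ^ i * s ^ (-j)`.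
  obtain ⟨v, -, -, h, U, U', -, -, hv⟩ := φ.exists_square e2 e3 hw2 hfst
  have m1 : Γ.vertex₁ g t ∈ Γ.cliqueCube h U U' := hv ▸ (by simp)
  have m2 : Γ.vertex₁ (g * k) s ∈ Γ.cliqueCube h U U' := hv ▸ (by simp)
  rw [vertex_mem_cliqueCube_iff, vertex_eq_vertex_iff, standardSubgroup_singleton] at m1 m2
  obtain ⟨i, hi⟩ := Subgroup.mem_zpowers_iff.1 m1.2.2
  obtain ⟨j, hj⟩ := Subgroup.mem_zpowers_iff.1 m2.2.2
  refine Γ.gen_mul_gen_ne_zpow_mul_zpow hadj hl3 i (-j) ?_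
  rw [hi, zpow_neg, hj, ← hk]
  group

/-- If at each vertex `g A_∅` all edges are in the direction of the same factor, and the second
factor is not a point, then some edge at the vertex `A_∅` is in the direction of the second factor. -/
theorem exists_snd_ne_of_iso [Nontrivial γ] (φ : CubeComplex.Iso (Y.prod Z) Γ.cliqueCubeComplex)
    (h : ∀ g, (∀ s, φ.snd (Γ.vertex₀ g) = φ.snd (Γ.vertex₁ g s)) ∨
      ∀ s, φ.fst (Γ.vertex₀ g) = φ.fst (Γ.vertex₁ g s)) :
    ∃ s, φ.snd (Γ.vertex₀ 1) ≠ φ.snd (Γ.vertex₁ 1 s) := by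
  by_contra! h1
  have step : ∀ g g' s, Γ.vertex₁ g s = Γ.vertex₁ g' s →
      (∀ s, φ.snd (Γ.vertex₀ g) = φ.snd (Γ.vertex₁ g s)) →
      φ.snd (Γ.vertex₀ g') = φ.snd (Γ.vertex₀ g) ∧
      ∀ s, φ.snd (Γ.vertex₀ g') = φ.snd (Γ.vertex₁ g' s) := by
    intro g g' s hs hg
    suffices H : ∀ s, φ.snd (Γ.vertex₀ g') = φ.snd (Γ.vertex₁ g' s) from
      ⟨by rw [H s, ← hs, hg s], H⟩
    refine (h g').elim id fun hg' => ?_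
    -- If the direction changed from `g` to `g'`, the edges from the common vertex `g A_{s}` to `g
    -- A_∅` and `g' A_∅` would span a square. Both ends have type `∅`, so they coincide and no
    -- change takes place.
    obtain ⟨w, -, -, hQ⟩ := φ.exists_square (x := Γ.vertex₁ g s) (y := Γ.vertex₀ g)
      (z := Γ.vertex₀ g') (by rw [Set.pair_comm]; exact isCube_vertex₀_vertex₁ g s)
      (by rw [Set.pair_comm, hs]; exact isCube_vertex₀_vertex₁ g' s) (hg s).symm
      (by rw [hs, hg' s])
    have e : Γ.vertex₀ g = Γ.vertex₀ g' := eq_of_mem_of_type_eq hQ (by simp) (by simp) rfl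
    intro s'
    have e' : Γ.vertex₁ g s' = Γ.vertex₁ g' s' := vertex_eq_of_subset (Finset.empty_subset _) e
    rw [← e, hg s', e']
  have all : ∀ g, φ.snd (Γ.vertex₀ g) = φ.snd (Γ.vertex₀ 1) ∧
      ∀ s, φ.snd (Γ.vertex₀ g) = φ.snd (Γ.vertex₁ g s) := by
    intro g
    have hg : g ∈ Subgroup.closure (Set.range (PresentedGroup.of (rels := Γ.artinRelators))) := by
      rw [PresentedGroup.closure_range_of]; trivial
    induction hg using Subgroup.closure_induction_right with
    | one => exact ⟨rfl, h1⟩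
    | mul_right x hx y hy ih =>
      obtain ⟨s, rfl⟩ := hy
      have := step x (x * Γ.gen s) s (by
        rw [vertex_eq_vertex_iff, standardSubgroup_singleton]; simp) ih.2
      exact ⟨this.1.trans ih.1, this.2⟩
    | mul_inv_cancel x hx y hy ih =>
      obtain ⟨s, rfl⟩ := hy
      have := step x (x * (Γ.gen s)⁻¹) s (by
        rw [vertex_eq_vertex_iff, standardSubgroup_singleton]; simp) ih.2
      exact ⟨this.1.trans ih.1, this.2⟩
  -- Every vertex `g A_U` lies in the cube `[g A_∅, g A_U]`, all of whose edges at `g A_∅` are in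
  -- the direction of the first factor.
  have const : ∀ x, φ.snd x = φ.snd (Γ.vertex₀ 1) := by
    intro x
    obtain ⟨g, hx⟩ := Γ.exists_eq_vertex x
    rw [← (all g).1]
    refine φ.snd_eq_of_isCube (Q := Γ.cliqueCube g ∅ x.type)
      ⟨g, _, _, Finset.empty_subset _, x.isClique, rfl⟩
      (vertex_mem_cliqueCube_iff.2 ⟨subset_rfl, Finset.empty_subset _, rfl⟩)
      (mem_cliqueCube_iff.2 ⟨Finset.empty_subset _, subset_rfl, hx⟩) fun z hz => ?_
    rcases exists_vertex₁_of_isCube_pair hz with rfl | ⟨s, rfl⟩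
    · rfl
    · exact (all g).2 s
  obtain ⟨c, hc⟩ := exists_ne (φ.snd (Γ.vertex₀ 1))
  obtain ⟨x, -, hx⟩ := φ.exists_fst_snd (φ.fst (Γ.vertex₀ 1)) c
  exact hc (hx ▸ const x)

/-- At a vertex `g A_∅` with edges in both directions, the join is given by the generators of either
direction. If there were no such vertex, the propagation argument, applied to both factors, would
produce both directions at `A_∅` itself. -/
theorem isReducible_of_iso_prod [Nontrivial β] [Nontrivial γ]
    (φ : CubeComplex.Iso (Y.prod Z) Γ.cliqueCubeComplex) : Γ.IsReducible := by
  obtain ⟨g, ⟨s, hs⟩, ⟨t, ht⟩⟩ : ∃ g, (∃ s, φ.snd (Γ.vertex₀ g) ≠ φ.snd (Γ.vertex₁ g s)) ∧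
      ∃ t, φ.fst (Γ.vertex₀ g) ≠ φ.fst (Γ.vertex₁ g t) := by
    by_contra! h
    have h' : ∀ g, (∀ s, φ.snd (Γ.vertex₀ g) = φ.snd (Γ.vertex₁ g s)) ∨
        ∀ s, φ.fst (Γ.vertex₀ g) = φ.fst (Γ.vertex₁ g s) := fun g => by
      by_contra! hg
      obtain ⟨⟨s, hs⟩, ⟨t, ht⟩⟩ := hg
      exact ht (h g ⟨s, hs⟩ t)
    obtain ⟨s, hs⟩ := exists_snd_ne_of_iso φ h'
    obtain ⟨t, ht⟩ := exists_snd_ne_of_iso φ.swap fun g => (h' g).symm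
    exact ht (h 1 ⟨s, hs⟩ t)
  have edge := fun v => φ.eq_or_eq_of_isCube_pair (isCube_vertex₀_vertex₁ g v)
  exact Γ.isReducible_iff_exists_set.2 ⟨{v | φ.snd (Γ.vertex₀ g) = φ.snd (Γ.vertex₁ g v)},
    ⟨t, (edge t).resolve_left ht⟩, ⟨s, hs⟩,
    fun v hv w hw => adj_and_label_eq_two_of_iso φ hv ((edge w).resolve_right hw)⟩

end Product

theorem isReducible_of_isReducible_cliqueCubeComplex (h : Γ.cliqueCubeComplex.IsReducible) :
    Γ.IsReducible := by
  obtain ⟨C', C'', h', h'', ⟨φ⟩⟩ := h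
  have := h'.coe_sort
  have := h''.coe_sort
  exact isReducible_of_iso_prod φ

end DefiningGraph

/-! ### Factors of a product as subcomplexes. -/

namespace CubeComplex

variable {α β γ δ ε : Type*} {X : CubeComplex α} {Y : CubeComplex β} {Z : CubeComplex γ}
  {Y' : CubeComplex δ} {Z' : CubeComplex ε}

/-- An isomorphism, from a bijection which maps cubes to cubes and whose inverse does so, too. -/
def Iso.ofMaps (e : α ≃ β) (h : ∀ Q, X.IsCube Q → Y.IsCube (e '' Q))
    (h' : ∀ Q, Y.IsCube Q → X.IsCube (e.symm '' Q)) : Iso X Y where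
  toEquiv := e
  isCube_iff Q := ⟨h Q, fun hQ => by simpa using h' _ hQ⟩

/-- The inverse of an isomorphism. -/
def Iso.symm (φ : Iso X Y) : Iso Y X where
  toEquiv := φ.toEquiv.symm
  isCube_iff Q := by rw [φ.isCube_iff]; simp

/-- Composition of isomorphisms. -/
def Iso.trans (φ : Iso X Y) (ψ : Iso Y Z) : Iso X Z where
  toEquiv := φ.toEquiv.trans ψ.toEquiv
  isCube_iff Q := by rw [φ.isCube_iff, ψ.isCube_iff, Set.image_image]; rfl

/-- The product of two isomorphisms. -/
def Iso.prodCongr (φ : Iso Y Y') (ψ : Iso Z Z') : Iso (Y.prod Z) (Y'.prod Z') :=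
  Iso.ofMaps (φ.toEquiv.prodCongr ψ.toEquiv)
    (by
      rintro _ ⟨A, B, hA, hB, rfl⟩
      exact ⟨_, _, (φ.isCube_iff A).1 hA, (ψ.isCube_iff B).1 hB, Set.prodMap_image_prod _ _ A B⟩)
    (by
      rintro _ ⟨A, B, hA, hB, rfl⟩
      exact ⟨_, _, (φ.symm.isCube_iff A).1 hA, (ψ.symm.isCube_iff B).1 hB, Set.prodMap_image_prod _ _ A B⟩)

/-- The copy `Y × {c}` of the first factor in a product. -/
def Iso.slice (φ : Iso (Y.prod Z) X) (c : γ) : X.Subcomplex where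
  cubes := {Q | X.IsCube Q ∧ ∀ x ∈ Q, φ.snd x = c}
  isCube_of_mem _ h := h.1
  mem_of_subset _ h _ hR hRQ := ⟨hR, fun x hx => h.2 x (hRQ hx)⟩

theorem Iso.mem_slice_verts (φ : Iso (Y.prod Z) X) {c : γ} {x : α} :
    x ∈ (φ.slice c).verts ↔ φ.snd x = c :=
  ⟨fun h => h.2 x rfl, fun h => ⟨X.isCube_singleton x, fun _ hy => hy ▸ h⟩⟩

/-- The copy `Y × {c}` of `Y` in a product is isomorphic to `Y`. -/
def Iso.sliceIso (φ : Iso (Y.prod Z) X) (c : γ) : Iso Y (φ.slice c).toCubeComplex :=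
  Iso.ofMaps
    { toFun b := ⟨φ.toEquiv (b, c), φ.mem_slice_verts.2 (by simp [Iso.snd])⟩
      invFun x := φ.fst x.1
      left_inv b := by simp [Iso.fst]
      right_inv x := Subtype.ext (φ.eq_of_fst_eq_of_snd_eq (by simp [Iso.fst])
        (by simpa [Iso.snd] using (φ.mem_slice_verts.1 x.2).symm)) }
    (by
      intro A hA
      refine ⟨(φ.isCube_iff_exists _).2 ⟨A, {c}, hA, Z.isCube_singleton c, fun x => ?_⟩, ?_⟩
      · constructor
        · rintro ⟨_, ⟨b, hb, rfl⟩, rfl⟩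
          simpa [Iso.fst, Iso.snd] using hb
        · rintro ⟨h1, h2⟩
          exact ⟨_, ⟨φ.fst x, h1, rfl⟩, φ.eq_of_fst_eq_of_snd_eq (by simp [Iso.fst])
            (by simpa [Iso.snd] using h2.symm)⟩
      · rintro _ ⟨y, -, rfl⟩
        exact φ.mem_slice_verts.1 y.2)
    (by
      rintro Q ⟨hQ, hQc⟩
      obtain ⟨A, B, hA, hB, h⟩ := (φ.isCube_iff_exists _).1 hQ
      convert hA
      ext b
      constructor
      · rintro ⟨x, hx, rfl⟩
        exact ((h x.1).1 ⟨x, hx, rfl⟩).1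
      · intro hb
        have hBne : B.Nonempty := by
          obtain ⟨n, f, -, rfl, -⟩ := Z.exists_coordinates B hB
          exact Set.range_nonempty f
        obtain ⟨c', hc'⟩ := hBne
        obtain ⟨x, h1, h2⟩ := φ.exists_fst_snd b c'
        obtain ⟨y, hy, rfl⟩ := (h x).2 ⟨h1 ▸ hb, h2 ▸ hc'⟩
        exact ⟨y, hy, h1⟩)

/-- Reducibility asks for subcomplexes of `X` itself, so the abstract factors are replaced by the
slices `Y × {c}` and `{b} × Z`. -/
theorem Iso.isReducible [Nontrivial β] [Nontrivial γ] (φ : Iso (Y.prod Z) X) : X.IsReducible := by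
  obtain ⟨b⟩ := (inferInstance : Nonempty β)
  obtain ⟨c⟩ := (inferInstance : Nonempty γ)
  have h1 := (φ.sliceIso c).toEquiv.symm.nontrivial
  have h2 := (φ.swap.sliceIso b).toEquiv.symm.nontrivial
  exact ⟨φ.slice c, φ.swap.slice b, Set.nontrivial_coe_sort.1 h1, Set.nontrivial_coe_sort.1 h2,
    ⟨(Iso.prodCongr (φ.sliceIso c).symm (φ.swap.sliceIso b).symm).trans φ⟩⟩

end CubeComplex

/-! ### The Artin group of a join with labels 2. -/

namespace DefiningGraph

variable {V : Type u} {Γ : DefiningGraph V}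

/-- The homomorphism of Artin groups induced by the inclusion of a subgraph. -/
def inclusion (H : Γ.graph.Subgraph) : (Γ.restrict H).ArtinGroup →* Γ.ArtinGroup :=
  (Γ.restrict H).liftArtin (fun s => Γ.gen s.1) fun _ _ h => Γ.alternatingProduct_gen_comm h.adj_sub

@[simp]
theorem inclusion_gen (H : Γ.graph.Subgraph) (s : H.verts) :
    inclusion H ((Γ.restrict H).gen s) = Γ.gen s.1 :=
  liftArtin_gen _ _ _ _

theorem hom_ext {G : Type v} [Group G] {φ ψ : Γ.ArtinGroup →* G}
    (h : ∀ s, φ (Γ.gen s) = ψ (Γ.gen s)) : φ = ψ :=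
  PresentedGroup.ext h

namespace IsTwoLabelledJoin

variable {Γ' Γ'' : Γ.graph.Subgraph} (h : Γ.IsTwoLabelledJoin Γ' Γ'')
include h

theorem mem_right {s : V} (hs : s ∉ Γ'.verts) : s ∈ Γ''.verts := by
  have : s ∈ Γ'.verts ∪ Γ''.verts := h.union_eq ▸ Set.mem_univ s
  exact this.resolve_left hs

theorem notMem_left {s : V} (hs : s ∈ Γ''.verts) : s ∉ Γ'.verts :=
  fun hs' => Set.disjoint_left.1 h.disjoint hs' hs

theorem adj {s t : V} (hs : s ∈ Γ'.verts) (ht : t ∈ Γ''.verts) : Γ.graph.Adj s t :=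
  (h.adj_iff s t).2 (Or.inr (Or.inr (Or.inl ⟨hs, ht⟩)))

theorem adj_left {s t : V} (hs : s ∈ Γ'.verts) (ht : t ∈ Γ'.verts) (hst : Γ.graph.Adj s t) :
    Γ'.Adj s t := by
  rcases (h.adj_iff s t).1 hst with h1 | h1 | h1 | h1
  · exact h1
  · exact absurd hs (h.notMem_left h1.fst_mem)
  · exact absurd ht (h.notMem_left h1.2)
  · exact absurd hs (h.notMem_left h1.1)

theorem adj_right {s t : V} (hs : s ∈ Γ''.verts) (ht : t ∈ Γ''.verts) (hst : Γ.graph.Adj s t) :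
    Γ''.Adj s t := by
  rcases (h.adj_iff s t).1 hst with h1 | h1 | h1 | h1
  · exact absurd h1.fst_mem (h.notMem_left hs)
  · exact h1
  · exact absurd h1.1 (h.notMem_left hs)
  · exact absurd h1.2 (h.notMem_left ht)

theorem commute_gen {s t : V} (hs : s ∈ Γ'.verts) (ht : t ∈ Γ''.verts) :
    Commute (Γ.gen s) (Γ.gen t) := by
  have := Γ.alternatingProduct_gen_comm (h.adj hs ht)
  rw [h.label_eq_two s hs t ht] at this
  simpa only [alternatingProduct, mul_one, commute_iff_eq] using this

theorem commute_inclusion (a : (Γ.restrict Γ').ArtinGroup) (b : (Γ.restrict Γ'').ArtinGroup) :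
    Commute (inclusion Γ' a) (inclusion Γ'' b) := by
  have key : ∀ (s : Γ'.verts) b, Commute (Γ.gen s.1) (inclusion Γ'' b) := fun s b => by
    have hb : b ∈ Subgroup.closure
        (Set.range (PresentedGroup.of (rels := (Γ.restrict Γ'').artinRelators))) := by
      rw [PresentedGroup.closure_range_of]; trivial
    induction hb using Subgroup.closure_induction with
    | mem _ hx =>
      obtain ⟨t, rfl⟩ := hx
      rw [inclusion_gen]
      exact h.commute_gen s.2 t.2
    | one => rw [map_one]; exact Commute.one_right _
    | mul x y _ _ hx hy => rw [map_mul]; exact hx.mul_right hy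
    | inv x _ hx => rw [map_inv]; exact hx.inv_right
  have ha : a ∈ Subgroup.closure
      (Set.range (PresentedGroup.of (rels := (Γ.restrict Γ').artinRelators))) := by
    rw [PresentedGroup.closure_range_of]; trivial
  induction ha using Subgroup.closure_induction with
  | mem _ hx =>
    obtain ⟨s, rfl⟩ := hx
    rw [inclusion_gen]
    exact key s b
  | one => rw [map_one]; exact Commute.one_left _
  | mul x y _ _ hx hy => rw [map_mul]; exact hx.mul_left hy
  | inv x _ hx => rw [map_inv]; exact hx.inv_left

/-- The homomorphism `A_Γ' × A_Γ'' → A_Γ`. -/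
def prodHom : (Γ.restrict Γ').ArtinGroup × (Γ.restrict Γ'').ArtinGroup →* Γ.ArtinGroup :=
  (inclusion Γ').noncommCoprod (inclusion Γ'') h.commute_inclusion

theorem prodHom_apply (a : (Γ.restrict Γ').ArtinGroup) (b : (Γ.restrict Γ'').ArtinGroup) :
    h.prodHom (a, b) = inclusion Γ' a * inclusion Γ'' b := rfl

open Classical in
/-- The images of the generators under the homomorphism `A_Γ → A_Γ' × A_Γ''`. -/
noncomputable def splitGen (s : V) : (Γ.restrict Γ').ArtinGroup × (Γ.restrict Γ'').ArtinGroup :=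
  if hs : s ∈ Γ'.verts then ((Γ.restrict Γ').gen ⟨s, hs⟩, 1)
  else (1, (Γ.restrict Γ'').gen ⟨s, h.mem_right hs⟩)

theorem splitGen_left (s : Γ'.verts) : h.splitGen s.1 = ((Γ.restrict Γ').gen s, 1) := by
  simp [splitGen]

theorem splitGen_right (s : Γ''.verts) : h.splitGen s.1 = (1, (Γ.restrict Γ'').gen s) := by
  simp [splitGen, h.notMem_left s.2]

/-- The homomorphism `A_Γ → A_Γ' × A_Γ''`. -/
noncomputable def splitHom :
    Γ.ArtinGroup →* (Γ.restrict Γ').ArtinGroup × (Γ.restrict Γ'').ArtinGroup :=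
  Γ.liftArtin h.splitGen fun s t hst => by
    by_cases hs : s ∈ Γ'.verts <;> by_cases ht : t ∈ Γ'.verts
    · have := congrArg (MonoidHom.inl _ (Γ.restrict Γ'').ArtinGroup) <|
        (Γ.restrict Γ').alternatingProduct_gen_comm (s := ⟨s, hs⟩) (t := ⟨t, ht⟩)
          (h.adj_left hs ht hst)
      rw [map_alternatingProduct, map_alternatingProduct] at this
      rw [h.splitGen_left ⟨s, hs⟩, h.splitGen_left ⟨t, ht⟩]
      exact this
    -- An edge across the join has label 2, so its relation only says that elements of the two
    -- different factors commute.
    · have ht' := h.mem_right ht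
      rw [h.splitGen_left ⟨s, hs⟩, h.splitGen_right ⟨t, ht'⟩, h.label_eq_two s hs t ht']
      simp [alternatingProduct]
    · have hs' := h.mem_right hs
      rw [h.splitGen_left ⟨t, ht⟩, h.splitGen_right ⟨s, hs'⟩, Sym2.eq_swap,
        h.label_eq_two t ht s hs']
      simp [alternatingProduct]
    · have := congrArg (MonoidHom.inr (Γ.restrict Γ').ArtinGroup _) <|
        (Γ.restrict Γ'').alternatingProduct_gen_comm (s := ⟨s, h.mem_right hs⟩)
          (t := ⟨t, h.mem_right ht⟩) (h.adj_right (h.mem_right hs) (h.mem_right ht) hst)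
      rw [map_alternatingProduct, map_alternatingProduct] at this
      rw [h.splitGen_right ⟨s, h.mem_right hs⟩, h.splitGen_right ⟨t, h.mem_right ht⟩]
      exact this

theorem splitHom_gen (s : V) : h.splitHom (Γ.gen s) = h.splitGen s :=
  Γ.liftArtin_gen _ _ s

/-- If `Γ` is the join of `Γ'` and `Γ''`, with all edges between them labelled by `2`, then `A_Γ` is
the product of `A_Γ'` and `A_Γ''`. -/
noncomputable def prodEquiv :
    (Γ.restrict Γ').ArtinGroup × (Γ.restrict Γ'').ArtinGroup ≃* Γ.ArtinGroup :=
  MonoidHom.toMulEquiv h.prodHom h.splitHom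
    (by
      have h1 : h.splitHom.comp (inclusion Γ') = MonoidHom.inl _ _ := hom_ext fun s => by
        rw [MonoidHom.comp_apply, inclusion_gen, splitHom_gen, splitGen_left]; rfl
      have h2 : h.splitHom.comp (inclusion Γ'') = MonoidHom.inr _ _ := hom_ext fun s => by
        rw [MonoidHom.comp_apply, inclusion_gen, splitHom_gen, splitGen_right]; rfl
      ext1 ⟨a, b⟩
      have h1 := DFunLike.congr_fun h1 a
      have h2 := DFunLike.congr_fun h2 b
      rw [MonoidHom.comp_apply] at h1 h2 ⊢
      rw [prodHom_apply, map_mul, h1, h2]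
      simp)
    (hom_ext fun s => by
      rw [MonoidHom.comp_apply, splitHom_gen]
      by_cases hs : s ∈ Γ'.verts
      · rw [h.splitGen_left ⟨s, hs⟩, prodHom_apply]; simp
      · rw [h.splitGen_right ⟨s, h.mem_right hs⟩, prodHom_apply]; simp)

theorem prodEquiv_apply (a : (Γ.restrict Γ').ArtinGroup) (b : (Γ.restrict Γ'').ArtinGroup) :
    h.prodEquiv (a, b) = inclusion Γ' a * inclusion Γ'' b := rfl

end IsTwoLabelledJoin

/-! ### The clique-cube complex of a join with labels 2. -/

open Classical in
/-- The union of a set of vertices of `Γ'` and a set of vertices of `Γ''`. -/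
noncomputable def joinFinset {Γ' Γ'' : Γ.graph.Subgraph} (U : Finset Γ'.verts)
    (T : Finset Γ''.verts) : Finset V :=
  U.map (Function.Embedding.subtype _) ∪ T.map (Function.Embedding.subtype _)

theorem mem_joinFinset {Γ' Γ'' : Γ.graph.Subgraph} {U : Finset Γ'.verts} {T : Finset Γ''.verts}
    {s : V} : s ∈ joinFinset U T ↔ (∃ hs, ⟨s, hs⟩ ∈ U) ∨ ∃ hs, ⟨s, hs⟩ ∈ T := by
  simp [joinFinset]

namespace IsTwoLabelledJoin

variable {Γ' Γ'' : Γ.graph.Subgraph} (h : Γ.IsTwoLabelledJoin Γ' Γ'')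
include h

theorem mem_joinFinset_left {U : Finset Γ'.verts} {T : Finset Γ''.verts} (s : Γ'.verts) :
    s.1 ∈ joinFinset U T ↔ s ∈ U := by
  rw [mem_joinFinset]
  exact ⟨fun hs => hs.elim (fun ⟨_, hs⟩ => hs) fun ⟨hs, _⟩ => absurd s.2 (h.notMem_left hs),
    fun hs => Or.inl ⟨s.2, hs⟩⟩

theorem mem_joinFinset_right {U : Finset Γ'.verts} {T : Finset Γ''.verts} (s : Γ''.verts) :
    s.1 ∈ joinFinset U T ↔ s ∈ T := by
  rw [mem_joinFinset]
  exact ⟨fun hs => hs.elim (fun ⟨hs, _⟩ => absurd hs (h.notMem_left s.2)) fun ⟨_, hs⟩ => hs,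
    fun hs => Or.inr ⟨s.2, hs⟩⟩

theorem joinFinset_subset_iff {U U' : Finset Γ'.verts} {T T' : Finset Γ''.verts} :
    joinFinset U T ⊆ joinFinset U' T' ↔ U ⊆ U' ∧ T ⊆ T' := by
  constructor
  · intro hs
    exact ⟨fun s hs' => (h.mem_joinFinset_left s).1 (hs ((h.mem_joinFinset_left s).2 hs')),
      fun s hs' => (h.mem_joinFinset_right s).1 (hs ((h.mem_joinFinset_right s).2 hs'))⟩
  · rintro ⟨h1, h2⟩ s hs
    rw [mem_joinFinset] at hs ⊢
    exact hs.imp (fun ⟨hs, hs'⟩ => ⟨hs, h1 hs'⟩) fun ⟨hs, hs'⟩ => ⟨hs, h2 hs'⟩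

theorem joinFinset_inj {U U' : Finset Γ'.verts} {T T' : Finset Γ''.verts} :
    joinFinset U T = joinFinset U' T' ↔ U = U' ∧ T = T' := by
  simp only [subset_antisymm_iff, h.joinFinset_subset_iff]
  tauto

theorem exists_eq_joinFinset (U : Finset V) :
    ∃ (U₁ : Finset Γ'.verts) (U₂ : Finset Γ''.verts), U = joinFinset U₁ U₂ := by
  classical
  refine ⟨U.subtype _, U.subtype _, ?_⟩
  ext s
  by_cases hs : s ∈ Γ'.verts
  · rw [h.mem_joinFinset_left ⟨s, hs⟩]; simp
  · rw [h.mem_joinFinset_right ⟨s, h.mem_right hs⟩]; simp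

theorem isClique_joinFinset_iff {U : Finset Γ'.verts} {T : Finset Γ''.verts} :
    Γ.graph.IsClique (joinFinset U T : Set V) ↔
      (Γ.restrict Γ').graph.IsClique (U : Set Γ'.verts) ∧
        (Γ.restrict Γ'').graph.IsClique (T : Set Γ''.verts) := by
  constructor
  · intro hc
    exact ⟨fun s hs t ht hst => h.adj_left s.2 t.2 (hc ((h.mem_joinFinset_left s).2 hs)
        ((h.mem_joinFinset_left t).2 ht) (Subtype.coe_injective.ne hst)),
      fun s hs t ht hst => h.adj_right s.2 t.2 (hc ((h.mem_joinFinset_right s).2 hs)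
        ((h.mem_joinFinset_right t).2 ht) (Subtype.coe_injective.ne hst))⟩
  · rintro ⟨h1, h2⟩ s hs t ht hst
    rw [Finset.mem_coe, mem_joinFinset] at hs ht
    rcases hs with ⟨hs, hs'⟩ | ⟨hs, hs'⟩ <;> rcases ht with ⟨ht, ht'⟩ | ⟨ht, ht'⟩
    · exact Γ'.adj_sub (h1 hs' ht' fun e => hst (congrArg Subtype.val e))
    · exact h.adj hs ht
    · exact (h.adj ht hs).symm
    · exact Γ''.adj_sub (h2 hs' ht' fun e => hst (congrArg Subtype.val e))

/-- `prodEquiv` matches generators with generators, hence also the standard subgroups they generate.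
One inclusion is checked through `splitHom`, the other through the two inclusions. All statements on
cosets and cubes below reduce to this one. -/
theorem prodEquiv_mem_iff {U : Finset Γ'.verts} {T : Finset Γ''.verts}
    {a : (Γ.restrict Γ').ArtinGroup} {b : (Γ.restrict Γ'').ArtinGroup} :
    h.prodEquiv (a, b) ∈ Γ.standardSubgroup (joinFinset U T) ↔
      a ∈ (Γ.restrict Γ').standardSubgroup U ∧ b ∈ (Γ.restrict Γ'').standardSubgroup T := by
  constructor
  · have hle : Γ.standardSubgroup (joinFinset U T) ≤
        (((Γ.restrict Γ').standardSubgroup U).prod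
          ((Γ.restrict Γ'').standardSubgroup T)).comap h.splitHom := by
      rw [standardSubgroup, Subgroup.closure_le]
      rintro _ ⟨s, hs, rfl⟩
      rw [SetLike.mem_coe, Subgroup.mem_comap, splitHom_gen, Subgroup.mem_prod]
      rcases mem_joinFinset.1 hs with ⟨hs, hs'⟩ | ⟨hs, hs'⟩
      · rw [h.splitGen_left ⟨s, hs⟩]
        exact ⟨Subgroup.subset_closure ⟨_, hs', rfl⟩, one_mem _⟩
      · rw [h.splitGen_right ⟨s, hs⟩]
        exact ⟨one_mem _, Subgroup.subset_closure ⟨_, hs', rfl⟩⟩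
    intro hab
    have := hle hab
    rw [Subgroup.mem_comap, show h.splitHom (h.prodEquiv (a, b)) = (a, b) from
      h.prodEquiv.symm_apply_apply (a, b)] at this
    exact this
  · have h1 : (Γ.restrict Γ').standardSubgroup U ≤
        (Γ.standardSubgroup (joinFinset U T)).comap (inclusion Γ') := by
      rw [standardSubgroup, Subgroup.closure_le]
      rintro _ ⟨s, hs, rfl⟩
      rw [SetLike.mem_coe, Subgroup.mem_comap, inclusion_gen]
      exact Subgroup.subset_closure ⟨s.1, (h.mem_joinFinset_left s).2 hs, rfl⟩
    have h2 : (Γ.restrict Γ'').standardSubgroup T ≤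
        (Γ.standardSubgroup (joinFinset U T)).comap (inclusion Γ'') := by
      rw [standardSubgroup, Subgroup.closure_le]
      rintro _ ⟨s, hs, rfl⟩
      rw [SetLike.mem_coe, Subgroup.mem_comap, inclusion_gen]
      exact Subgroup.subset_closure ⟨s.1, (h.mem_joinFinset_right s).2 hs, rfl⟩
    rintro ⟨ha, hb⟩
    rw [prodEquiv_apply]
    exact mul_mem (h1 ha) (h2 hb)

theorem image_prodEquiv_coset (a : (Γ.restrict Γ').ArtinGroup) (b : (Γ.restrict Γ'').ArtinGroup)
    (U : Finset Γ'.verts) (T : Finset Γ''.verts) :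
    h.prodEquiv '' ((a • ((Γ.restrict Γ').standardSubgroup U : Set (Γ.restrict Γ').ArtinGroup)) ×ˢ
        (b • ((Γ.restrict Γ'').standardSubgroup T : Set (Γ.restrict Γ'').ArtinGroup))) =
      h.prodEquiv (a, b) • (Γ.standardSubgroup (joinFinset U T) : Set Γ.ArtinGroup) := by
  ext x
  obtain ⟨⟨c, d⟩, rfl⟩ := h.prodEquiv.surjective x
  rw [h.prodEquiv.injective.mem_set_image, Set.mem_prod, mem_leftCoset_iff, mem_leftCoset_iff,
    mem_leftCoset_iff, ← map_inv, ← map_mul, SetLike.mem_coe, SetLike.mem_coe, SetLike.mem_coe,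
    Prod.inv_mk, Prod.mk_mul_mk, h.prodEquiv_mem_iff]

/-- The map from the vertices of `C_Γ' × C_Γ''` to those of `C_Γ`. -/
noncomputable def prodVertex (x : (Γ.restrict Γ').CliqueVertex × (Γ.restrict Γ'').CliqueVertex) :
    Γ.CliqueVertex where
  type := joinFinset x.1.type x.2.type
  coset := h.prodEquiv '' (x.1.coset ×ˢ x.2.coset)
  isClique := h.isClique_joinFinset_iff.2 ⟨x.1.isClique, x.2.isClique⟩
  exists_rep := by
    obtain ⟨a, ha⟩ := x.1.exists_rep
    obtain ⟨b, hb⟩ := x.2.exists_rep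
    exact ⟨h.prodEquiv (a, b), by rw [ha, hb, h.image_prodEquiv_coset]⟩

theorem prodVertex_vertex (a : (Γ.restrict Γ').ArtinGroup) (b : (Γ.restrict Γ'').ArtinGroup)
    {U : Finset Γ'.verts} {T : Finset Γ''.verts} (hU hT) :
    h.prodVertex ((Γ.restrict Γ').vertex a U hU, (Γ.restrict Γ'').vertex b T hT) =
      Γ.vertex (h.prodEquiv (a, b)) (joinFinset U T) (h.isClique_joinFinset_iff.2 ⟨hU, hT⟩) :=
  CliqueVertex.ext rfl (h.image_prodEquiv_coset a b U T)

theorem prodVertex_bijective : Function.Bijective h.prodVertex := by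
  constructor
  · rintro ⟨x, y⟩ ⟨x', y'⟩ hxy
    obtain ⟨a, hx⟩ := exists_eq_vertex _ x
    obtain ⟨b, hy⟩ := exists_eq_vertex _ y
    obtain ⟨a', hx'⟩ := exists_eq_vertex _ x'
    obtain ⟨b', hy'⟩ := exists_eq_vertex _ y'
    obtain ⟨h1, h2⟩ := h.joinFinset_inj.1 (congrArg CliqueVertex.type hxy)
    have hc := congrArg CliqueVertex.coset hxy
    -- A product of sets determines its factors once it is nonempty.
    have hne : ∀ {V : Type _} {Δ : DefiningGraph V} (x : Δ.CliqueVertex), x.coset.Nonempty := by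
      intro V Δ x
      obtain ⟨g, hg⟩ := x.exists_rep
      exact ⟨g, hg ▸ mem_own_leftCoset _ g⟩
    obtain ⟨h3, h4⟩ := (Set.prod_eq_prod_iff_of_nonempty ((hne x).prod (hne y))).1
      (h.prodEquiv.injective.image_injective hc)
    exact Prod.ext (CliqueVertex.ext h1 h3) (CliqueVertex.ext h2 h4)
  · rintro ⟨U, c, hU, g, rfl⟩
    obtain ⟨U₁, U₂, rfl⟩ := h.exists_eq_joinFinset U
    obtain ⟨⟨a, b⟩, rfl⟩ := h.prodEquiv.surjective g
    have hc := h.isClique_joinFinset_iff.1 hU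
    exact ⟨(vertex _ a U₁ hc.1, vertex _ b U₂ hc.2), h.prodVertex_vertex a b hc.1 hc.2⟩

theorem prodVertex_image_cliqueCube (a : (Γ.restrict Γ').ArtinGroup)
    (b : (Γ.restrict Γ'').ArtinGroup) (U U' : Finset Γ'.verts) (T T' : Finset Γ''.verts) :
    h.prodVertex '' ((Γ.restrict Γ').cliqueCube a U U' ×ˢ (Γ.restrict Γ'').cliqueCube b T T') =
      Γ.cliqueCube (h.prodEquiv (a, b)) (joinFinset U T) (joinFinset U' T') := by
  ext x
  obtain ⟨⟨y, z⟩, rfl⟩ := h.prodVertex_bijective.2 x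
  rw [h.prodVertex_bijective.1.mem_set_image, Set.mem_prod]
  obtain ⟨c, hy⟩ := exists_eq_vertex _ y
  obtain ⟨d, hz⟩ := exists_eq_vertex _ z
  rw [hy, hz, prodVertex_vertex, vertex_mem_cliqueCube_iff, vertex_mem_cliqueCube_iff,
    vertex_mem_cliqueCube_iff, vertex_eq_vertex_iff, vertex_eq_vertex_iff, vertex_eq_vertex_iff,
    h.joinFinset_subset_iff, h.joinFinset_subset_iff, ← map_inv, ← map_mul, Prod.inv_mk,
    Prod.mk_mul_mk, h.prodEquiv_mem_iff]
  tauto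

/-- If `Γ` is the join of `Γ'` and `Γ''`, with all edges between them labelled by `2`, then `C_Γ` is
the product of `C_Γ'` and `C_Γ''`. -/
noncomputable def prodIso :
    CubeComplex.Iso ((Γ.restrict Γ').cliqueCubeComplex.prod (Γ.restrict Γ'').cliqueCubeComplex)
      Γ.cliqueCubeComplex where
  toEquiv := Equiv.ofBijective _ h.prodVertex_bijective
  isCube_iff Q := by
    rw [Equiv.coe_ofBijective]
    constructor
    · rintro ⟨_, _, ⟨a, U, U', hU, hU', rfl⟩, ⟨b, T, T', hT, hT', rfl⟩, rfl⟩
      exact ⟨_, _, _, h.joinFinset_subset_iff.2 ⟨hU, hT⟩, h.isClique_joinFinset_iff.2 ⟨hU', hT'⟩,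
        h.prodVertex_image_cliqueCube a b U U' T T'⟩
    · rintro ⟨g, S, S', hS, hS', hQ⟩
      obtain ⟨U, T, rfl⟩ := h.exists_eq_joinFinset S
      obtain ⟨U', T', rfl⟩ := h.exists_eq_joinFinset S'
      obtain ⟨⟨a, b⟩, rfl⟩ := h.prodEquiv.surjective g
      rw [h.joinFinset_subset_iff] at hS
      rw [h.isClique_joinFinset_iff] at hS'
      rw [← h.prodVertex_image_cliqueCube] at hQ
      exact ⟨_, _, ⟨a, U, U', hS.1, hS'.1, rfl⟩, ⟨b, T, T', hS.2, hS'.2, rfl⟩,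
        h.prodVertex_bijective.1.image_injective hQ⟩

end IsTwoLabelledJoin

theorem nontrivial_cliqueVertex [Nonempty V] : Nontrivial Γ.CliqueVertex := by
  obtain ⟨s⟩ := (inferInstance : Nonempty V)
  exact ⟨Γ.vertex₀ 1, Γ.vertex₁ 1 s, fun h => by simpa using congrArg CliqueVertex.type h⟩

end DefiningGraph

theorem proposition4p6 {V : Type*} [Finite V] (Γ : DefiningGraph V) :
    List.TFAE [
      Γ.cliqueCubeComplex.IsReducible,
      Γ.IsReducible,
      ¬ Γ.tGraph.Preconnected,
      Γ.IsReducible ∧ ∀ Γ' Γ'' : Γ.graph.Subgraph, Γ.IsTwoLabelledJoin Γ' Γ'' →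
        Nonempty (CubeComplex.Iso
          ((Γ.restrict Γ').cliqueCubeComplex.prod (Γ.restrict Γ'').cliqueCubeComplex)
          Γ.cliqueCubeComplex)] := by
  tfae_have 1 → 2 := DefiningGraph.isReducible_of_isReducible_cliqueCubeComplex
  tfae_have 2 ↔ 3 := Γ.isReducible_iff_not_preconnected_tGraph
  tfae_have 2 → 4 := fun h => ⟨h, fun _ _ h' => ⟨h'.prodIso⟩⟩
  tfae_have 4 → 1 := by
    -- The first half of the statement supplies a join; without it the second half could hold
    -- vacuously.
    rintro ⟨⟨Γ', Γ'', h⟩, hiso⟩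
    obtain ⟨φ⟩ := hiso Γ' Γ'' h
    have := h.nonempty_left.to_subtype
    have := h.nonempty_right.to_subtype
    have := DefiningGraph.nontrivial_cliqueVertex (Γ := Γ.restrict Γ')
    have := DefiningGraph.nontrivial_cliqueVertex (Γ := Γ.restrict Γ'')
    exact φ.isReducible
  tfae_finish
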